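/- Let $d\ge 1$ be an integer and let $\mathbb{T}^d=\mathbb{R}^d/\mathbb{Z}^d$ carry the distance $\|x-y\|$, where $\|x\|=\min\{|x-z|_\infty : z\in\mathbb{Z}^d\}$ and $|\cdot|_\infty$ is the maximum norm. Let $\omega=(\omega_n)_{n\ge1}$ be independent random variables, each uniformly distributed on $\mathbb{T}^d$ (i.e. with law the Lebesgue measure). For $c>0$ put $\ell_n=c/n^{1/d}$ and let $$\mathcal U_c=\Big\{y\in\mathbb{T}^d:\ \exists p\ \ \forall N\ge p\ \ \exists\, 1\le n\le N,\ \|\omega_n-y\|<\ell_N\Big\}.$$ (1) If $c>\tfrac12$, then almost surely $$\dim_{\mathrm H}\mathcal U_c\ \ge\ \sup_{\theta>1} d\Big(1+\frac{\log\big(1-\exp(-(2c)^d\,\frac{\theta-1}{\theta^2})\big)}{\log\theta}\Big).$$ (2) If $0<c<\tfrac12$, then almost surely $$\dim_{\mathrm H}\mathcal U_c\ \le\ \inf_{\theta>1}\frac{\log\big(\Lambda(\theta)^d\big)}{\log\theta},$$ where $$\Lambda(\theta)=\frac{1+\Theta+\Delta}{2}+\sqrt{\Big(\frac{1+\Theta+\Delta}{2}\Big)^2-\Delta},$$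 $$\Theta=\Theta(\theta)=(\theta-1)\big(2c(1+\theta^{-2/d})\big)^d,\qquad \Delta=\Delta(\theta)=(\theta-1)\,2^d c^d\big((1+\theta^{-1/d})^d-(1+\theta^{-2/d})^d\big).$$ Here $\dim_{\mathrm H}$ denotes Hausdorff dimension. -/

import Mathlib

open MeasureTheory ProbabilityTheory Filter

noncomputable section

/-- The uniform covering set `U(x, ℓ)` of a sequence `x = (x₁, x₂, …)` of points of a metric space
and radii `ℓ = (ℓ₁, ℓ₂, …)`: the points `y` such that for all sufficiently large `N` there is
`1 ≤ n ≤ N` with `dist (xₙ) y < ℓ_N`. -/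
def uniformCoveringSet {X : Type*} [PseudoMetricSpace X] (x : ℕ+ → X) (ℓ : ℕ+ → ℝ) : Set X :=
  {y | ∀ᶠ N : ℕ+ in atTop, ∃ n : ℕ+, n ≤ N ∧ dist (x n) y < ℓ N}

/-- The critical radii `ℓₙ = c / n^{1/d}`. -/
def criticalRadius (d : ℕ) (c : ℝ) (n : ℕ+) : ℝ :=
  c / ((n : ℕ) : ℝ) ^ (1 / (d : ℝ))

/-- `d (1 + log (1 - exp (-(2c)^d (θ - 1) / θ²)) / log θ)`. -/
def lowerDimBound (d : ℕ) (c θ : ℝ) : ℝ :=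
  d * (1 + Real.log (1 - Real.exp (-((2 * c) ^ d * ((θ - 1) / θ ^ 2)))) / Real.log θ)

/-- `Θ(θ) = (θ - 1) (2c (1 + θ^{-2/d}))^d`. -/
def coveringTheta (d : ℕ) (c θ : ℝ) : ℝ :=
  (θ - 1) * (2 * c * (1 + θ ^ (-(2 / (d : ℝ))))) ^ d

/-- `Δ(θ) = (θ - 1) 2^d c^d ((1 + θ^{-1/d})^d - (1 + θ^{-2/d})^d)`. -/
def coveringDelta (d : ℕ) (c θ : ℝ) : ℝ :=
  (θ - 1) * 2 ^ d * c ^ d *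
    ((1 + θ ^ (-(1 / (d : ℝ)))) ^ d - (1 + θ ^ (-(2 / (d : ℝ)))) ^ d)

/-- `Λ(θ) = (1 + Θ + Δ)/2 + √(((1 + Θ + Δ)/2)² - Δ)`. -/
def coveringLambda (d : ℕ) (c θ : ℝ) : ℝ :=
  (1 + coveringTheta d c θ + coveringDelta d c θ) / 2 +
    Real.sqrt (((1 + coveringTheta d c θ + coveringDelta d c θ) / 2) ^ 2 - coveringDelta d c θ)

/-- `log (Λ(θ)^d) / log θ`. -/
def upperDimBound (d : ℕ) (c θ : ℝ) : ℝ :=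
  Real.log (coveringLambda d c θ ^ d) / Real.log θ

end

/-!
Both bounds come from looking at the geometric times `θ ^ k`, at which the covering radius is about
`c θ ^ (-k / d)`.

**Upper bound.** Call the `n`-th ball retained at stage `k` if it contains a point that was covered
at all earlier stages (`retained`). The retained balls of stage `k` cover the points of the uniform
covering set, so only their expected number `M k` has to be estimated. Let `S k` be the expected
number of those that are retained at stage `k + 1` as well. A ball that is retained at a stage
`j > k` has its centre within `r k + r j` of the centre of a ball retained at stage `k`, and a
centre that is new after stage `k` is independent of the latter (`retainedProb_le`). With
`j = k + 1` and `j = k + 2` this gives, up to rounding,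
`M (k + 1) ≤ S k + (Θ + Δ) M k` and `S (k + 1) ≤ S k + Θ M k`, a linear recursion whose matrix has
the characteristic polynomial `x ^ 2 - (1 + Θ + Δ) x + Δ`, with largest root `Λ(θ)`. Hence `M k`
grows at most like `lam ^ k` for each `lam > Λ(θ)`, and the Borel-Cantelli type argument of
`ae_hausdorffMeasure_coveredFrom_eq_zero` bounds the dimension by `log (Λ ^ d) / log θ`.

**Lower bound.** A point that is hit, for each large `k`, by one of the points of the block
`θ ^ k ≤ n < θ ^ (k + 1)` at the scale `c θ ^ (-(k + 2) / d)` lies in the uniform covering set. The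
blocks are independent and hit a given point with probability about
`1 - exp (-(2 c) ^ d (θ - 1) / θ ^ 2)`. Two points at distance more than twice the scale are hit in
a negatively correlated way (`measureReal_mem_hitSet_inter_le`), so the normalised uniform measures
`hitMeasure` on the points hit by the first blocks have a second moment close to one and a bounded
expected energy. A set that supports, approximately, measures with mass bounded below and energy
bounded above has positive Hausdorff measure (`hausdorffMeasure_iInter_ne_zero`). The probability of
failure tends to zero as the initial block moves to infinity, which makes the lower bound almost
sure without appeal to a zero-one law.

The bounds are first shown for one `θ`; a countable set of values of `θ` realises the supremum and
the infimum.
-/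

/-! ### Balls in the torus -/

theorem UnitAddTorus.volume_closedBall {d : ℕ} (x : UnitAddTorus (Fin d)) {r : ℝ} (hr : 0 ≤ r) :
    volume (Metric.closedBall x r) = ENNReal.ofReal (min 1 (2 * r)) ^ d := by
  rw [closedBall_pi x hr, volume_pi_pi]
  simp [AddCircle.volume_closedBall]

theorem UnitAddTorus.volume_closedBall_le {d : ℕ} (x : UnitAddTorus (Fin d)) {r : ℝ}
    (hr : 0 ≤ r) : volume (Metric.closedBall x r) ≤ ENNReal.ofReal ((2 * r) ^ d) := by
  rw [UnitAddTorus.volume_closedBall x hr, ENNReal.ofReal_pow (by positivity)]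
  gcongr
  exact min_le_right _ _

theorem UnitAddTorus.volume_closedBall_eq {d : ℕ} (x : UnitAddTorus (Fin d)) {r : ℝ}
    (hr : 0 ≤ r) (hr' : 2 * r ≤ 1) :
    volume (Metric.closedBall x r) = ENNReal.ofReal ((2 * r) ^ d) := by
  rw [UnitAddTorus.volume_closedBall x hr, min_eq_right hr', ENNReal.ofReal_pow (by positivity)]

/-! ### Independence of the past from a new point -/

section Independence

variable {Ω : Type*} [MeasurableSpace Ω] {P : Measure Ω} {d : ℕ}
  {X : ℕ → Ω → UnitAddTorus (Fin d)}

/-- The sequence with all terms from index `N` on replaced by `0`. -/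
def truncateSeq {T : Type*} [Zero T] (N : ℕ) (x : ℕ → T) : ℕ → T :=
  fun i => if i < N then x i else 0

theorem indepFun_truncateSeq (hX : ∀ n, Measurable (X n)) (hind : iIndepFun X P) {N n : ℕ}
    (hn : N ≤ n) : IndepFun (fun a => truncateSeq N (fun i => X i a)) (X n) P := by
  have h := hind.indepFun_finset (Finset.range N) {n} (by simp [hn]) hX
  let φ : ((i : Finset.range N) → UnitAddTorus (Fin d)) → ℕ → UnitAddTorus (Fin d) :=
    fun z i => if h : i ∈ Finset.range N then z ⟨i, h⟩ else 0
  have hφ : Measurable φ := by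
    refine measurable_pi_lambda _ fun i => ?_
    by_cases h : i ∈ Finset.range N
    · simp only [φ, h, dif_pos]; exact measurable_pi_apply _
    · simp only [φ, h]; exact measurable_const
  have h2 := h.comp hφ (measurable_pi_apply (⟨n, by simp⟩ : ({n} : Finset ℕ)))
  refine h2.congr (ae_of_all _ fun a => ?_) (ae_of_all _ fun a => rfl)
  funext i
  simp [φ, truncateSeq]

/-- A new uniform point is `r`-close to an earlier point with probability at most `(2 r) ^ d`,
even conditionally on an event `F` about the points with index less than `N`. -/
theorem measureReal_near_le [IsProbabilityMeasure P] (hX : ∀ n, Measurable (X n))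
    (hind : iIndepFun X P) (hunif : ∀ n, Measure.map (X n) P = volume)
    {F : Set (ℕ → UnitAddTorus (Fin d))}
    (hF : MeasurableSet F) {N m n : ℕ}
    (hdep : ∀ x, x ∈ F ↔ truncateSeq N x ∈ F) (hm : m < N) (hn : N ≤ n) {r : ℝ} (hr : 0 ≤ r) :
    P.real {a | (fun i => X i a) ∈ F ∧ dist (X n a) (X m a) < r} ≤
      P.real ((fun a i => X i a) ⁻¹' F) * (2 * r) ^ d := by
  have hZ : Measurable (fun a => truncateSeq N (fun i => X i a)) := by
    refine measurable_pi_lambda _ fun i => ?_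
    by_cases h : i < N
    · simpa [truncateSeq, h] using hX i
    · simp [truncateSeq, h]
  have hmap := (indepFun_iff_map_prod_eq_prod_map_map hZ.aemeasurable (hX n).aemeasurable).1
    (indepFun_truncateSeq hX hind hn)
  set Z := fun a => truncateSeq N (fun i => X i a) with hZdef
  let G : Set ((ℕ → UnitAddTorus (Fin d)) × UnitAddTorus (Fin d)) :=
    {p | p.1 ∈ F ∧ dist p.2 (p.1 m) < r}
  have hG : MeasurableSet G := by
    refine (measurable_fst hF).inter ?_
    exact measurableSet_lt (measurable_snd.dist ((measurable_pi_apply m).comp measurable_fst))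
      measurable_const
  have e1 : {a | (fun i => X i a) ∈ F ∧ dist (X n a) (X m a) < r} =
      (fun a => (Z a, X n a)) ⁻¹' G := by
    ext a
    simp only [Set.mem_ofPred_eq, Set.mem_preimage, G]
    rw [hdep]
    simp [hZdef, truncateSeq, hm]
  have e2 : (fun a i => X i a) ⁻¹' F = Z ⁻¹' F := by
    ext a
    exact hdep _
  have key : P ((fun a => (Z a, X n a)) ⁻¹' G) ≤ P (Z ⁻¹' F) * ENNReal.ofReal ((2 * r) ^ d) := by
    rw [← Measure.map_apply (hZ.prodMk (hX n)) hG, hmap, Measure.prod_apply hG, hunif,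
      ← Measure.map_apply hZ hF, mul_comm, ← lintegral_indicator_const hF]
    refine lintegral_mono fun x => ?_
    by_cases hx : x ∈ F
    · rw [Set.indicator_of_mem hx]
      refine (measure_mono ?_).trans (UnitAddTorus.volume_closedBall_le (x m) hr)
      intro y hy
      exact hy.2.le
    · rw [Set.indicator_of_notMem hx, nonpos_iff_eq_zero]
      convert measure_empty (μ := volume)
      ext y
      simp [G, hx]
  rw [e1, e2, measureReal_def, measureReal_def,
    ← ENNReal.toReal_ofReal (show 0 ≤ (2 * r) ^ d by positivity), ← ENNReal.toReal_mul]
  exact ENNReal.toReal_mono (by finiteness) key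

end Independence

/-! ### Balls that still meet the covered set -/

section Retained

variable {T : Type*} [PseudoMetricSpace T]

/-- The sequences `x` for which the `n`-th ball is retained at stage `k`: the ball of centre `x n`
and radius `r k` contains a point `y` that was covered at each of the stages `k₀ ≤ j < k`, that is,
lies within `r j` of one of the first `N j` points. -/
def retained (N : ℕ → ℕ) (r : ℕ → ℝ) (k₀ k n : ℕ) : Set (ℕ → T) :=
  {x | ∃ y, dist (x n) y < r k ∧ ∀ j, k₀ ≤ j → j < k → ∃ m < N j, dist (x m) y < r j}

variable {N : ℕ → ℕ} {r : ℕ → ℝ} {k₀ k j n : ℕ}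

theorem isOpen_retained : IsOpen (retained N r k₀ k n : Set (ℕ → T)) := by
  have h : (retained N r k₀ k n : Set (ℕ → T)) = ⋃ y : T, {x | dist (x n) y < r k} ∩
      ⋂ j ∈ Finset.Ico k₀ k, ⋃ m ∈ Finset.range (N j), {x | dist (x m) y < r j} := by
    ext x
    simp [retained]
  rw [h]
  have ho : ∀ (m : ℕ) (y : T) (s : ℝ), IsOpen {x : ℕ → T | dist (x m) y < s} := fun m y s =>
    isOpen_lt ((continuous_apply m).dist continuous_const) continuous_const
  exact isOpen_iUnion fun y => (ho _ _ _).inter <|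
    isOpen_biInter_finset fun j _ => isOpen_biUnion fun m _ => ho _ _ _

theorem mem_retained_truncateSeq [Zero T] (hN : Monotone N) (hn : n < N k) (x : ℕ → T) :
    x ∈ retained N r k₀ k n ↔ truncateSeq (N k) x ∈ retained N r k₀ k n := by
  have h : ∀ j ≤ k, ∀ m < N j, truncateSeq (N k) x m = x m := fun j hj m hm => by
    simp [truncateSeq, hm.trans_le (hN hj)]
  simp only [retained, Set.mem_ofPred_eq]
  refine exists_congr fun y => and_congr (by rw [h k le_rfl n hn]) ?_
  refine forall_congr' fun j => imp_congr_right fun _ => imp_congr_right fun hj => ?_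
  refine exists_congr fun m => and_congr_right fun hm => ?_
  rw [h j hj.le m hm]

theorem retained_anti (hr : Antitone r) (hkj : k ≤ j) :
    (retained N r k₀ j n : Set (ℕ → T)) ⊆ retained N r k₀ k n := by
  rintro x ⟨y, h1, h2⟩
  exact ⟨y, h1.trans_le (hr hkj), fun i hi hik => h2 i hi (hik.trans_le hkj)⟩

/-- A ball retained at stage `j` has its centre within `r j + r k` of the centre of a ball retained
at any earlier stage `k`. -/
theorem exists_near_of_mem_retained (hk : k₀ ≤ k) (hkj : k < j) {x : ℕ → T}
    (hx : x ∈ retained N r k₀ j n) :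
    ∃ m < N k, x ∈ retained N r k₀ k m ∧ dist (x n) (x m) < r k + r j := by
  obtain ⟨y, h1, h2⟩ := hx
  obtain ⟨m, hm, hmy⟩ := h2 k hk hkj
  refine ⟨m, hm, ⟨y, hmy, fun i hi hik => h2 i hi (hik.trans hkj)⟩, ?_⟩
  have := dist_triangle_right (x n) (x m) y
  linarith

end Retained

/-! ### Expected number of retained balls -/

section Expectation

variable {Ω : Type*} [MeasurableSpace Ω] {P : Measure Ω} [IsProbabilityMeasure P] {d : ℕ}
  {X : ℕ → Ω → UnitAddTorus (Fin d)} {N : ℕ → ℕ} {r : ℕ → ℝ} {k₀ : ℕ}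

/-- Probability that the `n`-th ball is retained at stage `k`. -/
noncomputable def retainedProb (P : Measure Ω) (X : ℕ → Ω → UnitAddTorus (Fin d)) (N : ℕ → ℕ)
    (r : ℕ → ℝ) (k₀ k n : ℕ) : ℝ :=
  P.real ((fun a i => X i a) ⁻¹' retained N r k₀ k n)

theorem retainedProb_anti (hr : Antitone r) {k j n : ℕ} (hkj : k ≤ j) :
    retainedProb P X N r k₀ j n ≤ retainedProb P X N r k₀ k n :=
  measureReal_mono (Set.preimage_mono (retained_anti hr hkj)) (measure_ne_top _ _)

/-- A point that is new after stage `k` is retained at a later stage `j` with probability at most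
`(2 (r k + r j)) ^ d` times the expected number of balls retained at stage `k`. -/
theorem retainedProb_le (hX : ∀ n, Measurable (X n)) (hind : iIndepFun X P)
    (hunif : ∀ n, Measure.map (X n) P = volume) (hN : Monotone N) (hr : ∀ k, 0 ≤ r k)
    {k j n : ℕ} (hk : k₀ ≤ k) (hkj : k < j) (hn : N k ≤ n) :
    retainedProb P X N r k₀ j n ≤
      (∑ m ∈ Finset.range (N k), retainedProb P X N r k₀ k m) * (2 * (r k + r j)) ^ d := by
  rw [Finset.sum_mul]
  calc retainedProb P X N r k₀ j n
      ≤ P.real (⋃ m ∈ Finset.range (N k), {a | (fun i => X i a) ∈ retained N r k₀ k m ∧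
          dist (X n a) (X m a) < r k + r j}) := by
        refine measureReal_mono (fun a ha => ?_) (measure_ne_top _ _)
        obtain ⟨m, hm, h1, h2⟩ := exists_near_of_mem_retained (x := fun i => X i a) hk hkj ha
        simp only [Set.mem_iUnion, Finset.mem_range]
        exact ⟨m, hm, h1, h2⟩
    _ ≤ ∑ m ∈ Finset.range (N k), P.real {a | (fun i => X i a) ∈ retained N r k₀ k m ∧
          dist (X n a) (X m a) < r k + r j} := measureReal_biUnion_finset_le _ _
    _ ≤ _ := by
        refine Finset.sum_le_sum fun m hm => ?_
        have hm' := Finset.mem_range.1 hm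
        exact measureReal_near_le (F := retained N r k₀ k m) hX hind hunif
          isOpen_retained.measurableSet (mem_retained_truncateSeq hN hm') hm' hn
          (add_nonneg (hr k) (hr j))

/-- Counting the centres with index below `N (k + 1)` that are retained at the stage `j > k`: the
old ones, and the new ones, which are controlled by the balls retained at stage `k`. -/
theorem sum_retainedProb_le (hX : ∀ n, Measurable (X n)) (hind : iIndepFun X P)
    (hunif : ∀ n, Measure.map (X n) P = volume) (hN : Monotone N) (hr : ∀ k, 0 ≤ r k)
    (hr' : Antitone r) {k j : ℕ} (hk : k₀ ≤ k) (hkj : k < j) :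
    ∑ n ∈ Finset.range (N (k + 1)), retainedProb P X N r k₀ j n ≤
      ∑ n ∈ Finset.range (N k), retainedProb P X N r k₀ (k + 1) n +
        ((N (k + 1) : ℝ) - N k) * (2 * (r k + r j)) ^ d *
          ∑ n ∈ Finset.range (N k), retainedProb P X N r k₀ k n := by
  have hNk : N k ≤ N (k + 1) := hN (Nat.le_succ k)
  rw [← Finset.sum_range_add_sum_Ico _ hNk]
  refine add_le_add (Finset.sum_le_sum fun n _ => retainedProb_anti hr' hkj) ?_
  calc _ ≤ ∑ n ∈ Finset.Ico (N k) (N (k + 1)),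
        (∑ m ∈ Finset.range (N k), retainedProb P X N r k₀ k m) * (2 * (r k + r j)) ^ d :=
        Finset.sum_le_sum fun n hn => retainedProb_le hX hind hunif hN hr hk hkj
          (Finset.mem_Ico.1 hn).1
    _ = _ := by
        rw [Finset.sum_const, Nat.card_Ico, nsmul_eq_mul, Nat.cast_sub hNk]
        ring

end Expectation

/-! ### A linear recursion -/

/-- Growth of a linear recursion: the condition on `lam` says that it is at least the
spectral radius of the matrix `!![G, 1; H, 1]`. -/
theorem exists_le_geometric_of_recursion {M S : ℕ → ℝ} {k₀ : ℕ} {G H lam : ℝ} (hG : 0 ≤ G)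
    (hH : 0 < H) (hlam : 1 < lam) (hGH : H / (lam - 1) + G ≤ lam)
    (hM : ∀ k, k₀ ≤ k → M (k + 1) ≤ S k + G * M k)
    (hS : ∀ k, k₀ ≤ k → S (k + 1) ≤ S k + H * M k) :
    ∃ C, 0 ≤ C ∧ ∀ k, k₀ ≤ k → M k ≤ C * lam ^ k := by
  have hl : 0 < lam - 1 := by linarith
  have ha : 0 < H / (lam - 1) := by positivity
  set a := H / (lam - 1) with hadef
  have hHa : H = a * (lam - 1) := by rw [hadef]; field_simp
  have hp : ∀ k, 0 < lam ^ k := fun k => by positivity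
  let C := max 0 (max (M k₀ / lam ^ k₀) (S k₀ / (a * lam ^ k₀)))
  have hC : 0 ≤ C := le_max_left _ _
  refine ⟨C, hC, ?_⟩
  suffices h : ∀ k, k₀ ≤ k → M k ≤ C * lam ^ k ∧ S k ≤ C * a * lam ^ k from fun k hk => (h k hk).1
  intro k hk
  induction k, hk using Nat.le_induction with
  | base =>
    constructor
    · rw [← div_le_iff₀ (hp _)]
      exact (le_max_left _ _).trans (le_max_right _ _)
    · rw [mul_assoc, ← div_le_iff₀ (by positivity)]
      exact (le_max_right _ _).trans (le_max_right _ _)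
  | succ k hk ih =>
    obtain ⟨h1, h2⟩ := ih
    have hq : 0 ≤ C * lam ^ k := mul_nonneg hC (hp k).le
    constructor
    · calc M (k + 1) ≤ S k + G * M k := hM k hk
        _ ≤ C * a * lam ^ k + G * (C * lam ^ k) := by gcongr
        _ = (C * lam ^ k) * (a + G) := by ring
        _ ≤ (C * lam ^ k) * lam := by gcongr
        _ = C * lam ^ (k + 1) := by ring
    · calc S (k + 1) ≤ S k + H * M k := hS k hk
        _ ≤ C * a * lam ^ k + H * (C * lam ^ k) := by gcongr
        _ = C * a * lam ^ (k + 1) := by rw [hHa]; ring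

/-! ### The exponent -/

section Exponent

variable {d : ℕ} {c θ : ℝ}

theorem coveringTheta_pos (hc : 0 < c) (hθ : 1 < θ) : 0 < coveringTheta d c θ := by
  have : 0 < θ - 1 := by linarith
  have : 0 < θ := by linarith
  unfold coveringTheta
  positivity

theorem one_le_coveringLambda (hc : 0 < c) (hθ : 1 < θ) : 1 ≤ coveringLambda d c θ := by
  have h := coveringTheta_pos (d := d) hc hθ
  unfold coveringLambda
  set B := (1 + coveringTheta d c θ + coveringDelta d c θ) / 2 with hB
  have : 1 - B ≤ Real.sqrt (B ^ 2 - coveringDelta d c θ) := by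
    refine Real.le_sqrt_of_sq_le ?_
    nlinarith
  linarith

/-- Every `lam` above `coveringLambda` dominates the recursion for the retained balls, with some
room to spare for the rounding of the numbers of points. -/
theorem exists_room_of_coveringLambda_lt (hc : 0 < c) (hθ : 1 < θ) {lam : ℝ}
    (hlam : coveringLambda d c θ < lam) : ∃ ε > 0,
      (θ - 1 + ε) * (2 * c * (1 + θ ^ (-(2 / (d : ℝ))))) ^ d / (lam - 1) +
        (θ - 1 + ε) * (2 * c * (1 + θ ^ (-(1 / (d : ℝ))))) ^ d < lam := by
  have hl1 : 0 < lam - 1 := by linarith [one_le_coveringLambda (d := d) hc hθ]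
  have hΘ : coveringTheta d c θ = (θ - 1) * (2 * c * (1 + θ ^ (-(2 / (d : ℝ))))) ^ d := rfl
  have hΔ : coveringDelta d c θ = (θ - 1) * (2 * c * (1 + θ ^ (-(1 / (d : ℝ))))) ^ d -
      coveringTheta d c θ := by
    rw [hΘ]; unfold coveringDelta; simp only [mul_pow]; ring
  set g := (2 * c * (1 + θ ^ (-(1 / (d : ℝ))))) ^ d
  set h := (2 * c * (1 + θ ^ (-(2 / (d : ℝ))))) ^ d
  have h0 : (θ - 1) * h / (lam - 1) + (θ - 1) * g < lam := by
    have hq : 0 < lam ^ 2 - (1 + coveringTheta d c θ + coveringDelta d c θ) * lam +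
        coveringDelta d c θ := by
      unfold coveringLambda at hlam
      set B := (1 + coveringTheta d c θ + coveringDelta d c θ) / 2 with hB
      have h1 : Real.sqrt (B ^ 2 - coveringDelta d c θ) < lam - B := by linarith
      have := Real.lt_sq_of_sqrt_lt h1
      nlinarith
    rw [div_add' _ _ _ hl1.ne', div_lt_iff₀ hl1]
    rw [hΔ, hΘ] at hq
    nlinarith
  have hcont : Tendsto (fun ε : ℝ => (θ - 1 + ε) * h / (lam - 1) + (θ - 1 + ε) * g)
      (nhdsWithin 0 (Set.Ioi 0)) (nhds ((θ - 1 + 0) * h / (lam - 1) + (θ - 1 + 0) * g)) :=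
    (Continuous.tendsto (by fun_prop) 0).mono_left nhdsWithin_le_nhds
  rw [add_zero] at hcont
  obtain ⟨ε, h1, h2⟩ := ((hcont.eventually (gt_mem_nhds h0)).and self_mem_nhdsWithin).exists
  exact ⟨ε, h2, h1⟩

end Exponent

/-! ### Growth of the number of retained balls -/

section UpperBound

variable {Ω : Type*} [MeasurableSpace Ω] {P : Measure Ω} [IsProbabilityMeasure P] {d : ℕ}
  {X : ℕ → Ω → UnitAddTorus (Fin d)} {c θ : ℝ}

/-- The scales `c θ ^ (-k / d)`. -/
noncomputable def scale (d : ℕ) (c θ : ℝ) (k : ℕ) : ℝ := c * (θ ^ (-(1 / (d : ℝ)))) ^ k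

theorem scale_nonneg (hc : 0 ≤ c) (hθ : 1 < θ) (k : ℕ) : 0 ≤ scale d c θ k := by
  have : 0 < θ := by linarith
  unfold scale; positivity

theorem scale_antitone (hc : 0 ≤ c) (hθ : 1 < θ) : Antitone (scale d c θ) := by
  intro j k h
  have h0 : 0 ≤ θ ^ (-(1 / (d : ℝ))) := Real.rpow_nonneg (by linarith) _
  have h1 : θ ^ (-(1 / (d : ℝ))) ≤ 1 :=
    Real.rpow_le_one_of_one_le_of_nonpos hθ.le (by simp)
  exact mul_le_mul_of_nonneg_left (pow_le_pow_of_le_one h0 h1 h) hc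

theorem tendsto_scale (hd : 1 ≤ d) (hθ : 1 < θ) : Tendsto (scale d c θ) atTop (nhds 0) := by
  have h0 : 0 ≤ θ ^ (-(1 / (d : ℝ))) := Real.rpow_nonneg (by linarith) _
  have h1 : θ ^ (-(1 / (d : ℝ))) < 1 :=
    Real.rpow_lt_one_of_one_lt_of_neg hθ (by simp; omega)
  have h := (tendsto_pow_atTop_nhds_zero_of_lt_one h0 h1).const_mul c
  rwa [mul_zero] at h

theorem scale_pow (hθ : 1 < θ) (k : ℕ) :
    (θ ^ (-(1 / (d : ℝ)))) ^ k = (θ ^ k) ^ (-(1 / (d : ℝ))) := by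
  have : 0 < θ := by linarith
  rw [← Real.rpow_natCast, ← Real.rpow_natCast, ← Real.rpow_mul this.le, ← Real.rpow_mul this.le,
    mul_comm]

theorem scale_ratio_pow (hd : 1 ≤ d) (hθ : 1 < θ) : (θ ^ (-(1 / (d : ℝ)))) ^ d = θ⁻¹ := by
  have : 0 < θ := by linarith
  rw [← Real.rpow_natCast, ← Real.rpow_mul this.le]
  have : (d : ℝ) ≠ 0 := by positivity
  rw [neg_mul, one_div_mul_cancel this, Real.rpow_neg_one]

/-- The expected number of balls retained at stage `k` grows at most like `lam ^ k`. -/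
theorem exists_sum_retainedProb_le (hd : 1 ≤ d) (hX : ∀ n, Measurable (X n))
    (hind : iIndepFun X P) (hunif : ∀ n, Measure.map (X n) P = volume) (hc : 0 < c) (hθ : 1 < θ)
    {lam : ℝ} (hlam : coveringLambda d c θ < lam) : ∀ᶠ k₀ in atTop, ∃ C, 0 ≤ C ∧ ∀ k, k₀ ≤ k →
      ∑ n ∈ Finset.range ⌈θ ^ k⌉₊,
        retainedProb P X (fun k => ⌈θ ^ k⌉₊) (scale d c θ) k₀ k n ≤ C * lam ^ k := by
  have hθ0 : 0 < θ := by linarith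
  obtain ⟨ε, hε, hroom⟩ := exists_room_of_coveringLambda_lt hc hθ hlam
  have hev : ∀ᶠ k : ℕ in atTop, ε⁻¹ ≤ θ ^ k :=
    (tendsto_pow_atTop_atTop_of_one_lt hθ).eventually_ge_atTop _
  obtain ⟨k₁, hk₁⟩ := eventually_atTop.1 hev
  filter_upwards [eventually_ge_atTop k₁] with k₀ hk₀
  have hN : Monotone fun k : ℕ => ⌈θ ^ k⌉₊ := fun j k h =>
    Nat.ceil_mono (pow_le_pow_right₀ hθ.le h)
  have hr := scale_antitone (d := d) hc.le hθ
  have hr0 := scale_nonneg (d := d) hc.le hθ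
  have hcount : ∀ k, k₀ ≤ k → ((⌈θ ^ (k + 1)⌉₊ : ℝ) - ⌈θ ^ k⌉₊) ≤ θ ^ k * (θ - 1 + ε) := by
    intro k hk
    have h1 := (Nat.ceil_lt_add_one (show 0 ≤ θ ^ (k + 1) by positivity)).le
    have h2 := Nat.le_ceil (θ ^ k)
    have h3 : 1 ≤ θ ^ k * ε := by
      have := hk₁ k (hk₀.trans hk)
      rwa [inv_le_iff_one_le_mul₀ hε] at this
    have h4 : θ ^ (k + 1) = θ ^ k * θ := pow_succ _ _
    linarith [h4, mul_sub (θ ^ k) θ 1, mul_add (θ ^ k) (θ - 1) ε]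
  -- the volume factor times the number of new points no longer depends on the stage
  have hvol : ∀ (k : ℕ) (i : ℕ), k₀ ≤ k →
      ((⌈θ ^ (k + 1)⌉₊ : ℝ) - ⌈θ ^ k⌉₊) * (2 * (scale d c θ k + scale d c θ (k + i))) ^ d ≤
        (θ - 1 + ε) * (2 * c * (1 + θ ^ (-(i / (d : ℝ))))) ^ d := by
    intro k i hk
    have e : 2 * (scale d c θ k + scale d c θ (k + i)) =
        (2 * c * (1 + θ ^ (-(i / (d : ℝ))))) * (θ ^ (-(1 / (d : ℝ)))) ^ k := by
      have : θ ^ (-(i / (d : ℝ))) = (θ ^ (-(1 / (d : ℝ)))) ^ i := by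
        rw [← Real.rpow_natCast, ← Real.rpow_mul hθ0.le]; congr 1; ring
      rw [this]; unfold scale; ring
    rw [e, mul_pow, ← pow_mul, mul_comm k d, pow_mul, scale_ratio_pow hd hθ]
    calc _ ≤ θ ^ k * (θ - 1 + ε) *
          ((2 * c * (1 + θ ^ (-(i / (d : ℝ))))) ^ d * θ⁻¹ ^ k) := by
          gcongr
          exact hcount k hk
      _ = _ := by
          rw [inv_pow]; field_simp
  have hεθ : 0 < θ - 1 + ε := by linarith
  have hsum0 : ∀ k, 0 ≤ ∑ n ∈ Finset.range ⌈θ ^ k⌉₊,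
      retainedProb P X (fun k => ⌈θ ^ k⌉₊) (scale d c θ) k₀ k n := fun k =>
    Finset.sum_nonneg fun n _ => measureReal_nonneg
  refine exists_le_geometric_of_recursion
    (S := fun k => ∑ n ∈ Finset.range ⌈θ ^ k⌉₊,
        retainedProb P X (fun k => ⌈θ ^ k⌉₊) (scale d c θ) k₀ (k + 1) n)
    (by positivity) (by positivity)
    ((one_le_coveringLambda (d := d) hc hθ).trans_lt hlam) hroom.le (fun k hk => ?_)
    (fun k hk => ?_)
  · refine (sum_retainedProb_le hX hind hunif hN hr0 hr hk (Nat.lt_succ_self k)).trans ?_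
    have := hvol k 1 hk
    rw [Nat.cast_one] at this
    gcongr
    exact hsum0 k
  · refine (sum_retainedProb_le hX hind hunif hN hr0 hr hk (show k < k + 2 by omega)).trans ?_
    have := hvol k 2 hk
    rw [Nat.cast_two] at this
    gcongr
    exact hsum0 k

end UpperBound

/-! ### Almost sure upper bound -/

/-- The points covered at every time `N ≥ p` by one of the first `N` balls of radius `ℓ N`. -/
def coveredFrom {T : Type*} [PseudoMetricSpace T] (x : ℕ → T) (ℓ : ℕ → ℝ) (p : ℕ) : Set T :=
  {y | ∀ N, p ≤ N → ∃ n < N, dist (x n) y < ℓ N}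

section UpperBound

variable {Ω : Type*} [MeasurableSpace Ω] {P : Measure Ω} [IsProbabilityMeasure P] {d : ℕ}
  {X : ℕ → Ω → UnitAddTorus (Fin d)} {c θ : ℝ}

theorem upperDimBound_nonneg (hc : 0 < c) (hθ : 1 < θ) : 0 ≤ upperDimBound d c θ :=
  div_nonneg (Real.log_nonneg (one_le_pow₀ (one_le_coveringLambda hc hθ))) (Real.log_nonneg hθ.le)

theorem coveringLambda_lt_of_upperDimBound_lt (hd : 1 ≤ d) (hc : 0 < c) (hθ : 1 < θ) {s : ℝ}
    (hs : upperDimBound d c θ < s) : coveringLambda d c θ < ((θ ^ (-(1 / (d : ℝ)))) ^ s)⁻¹ := by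
  have hθ0 : 0 < θ := by linarith
  have hd0 : (0 : ℝ) < d := by positivity
  have hΛ : 0 < coveringLambda d c θ := by linarith [one_le_coveringLambda (d := d) hc hθ]
  unfold upperDimBound at hs
  rw [div_lt_iff₀ (Real.log_pos hθ), Real.log_pow] at hs
  rw [← Real.log_lt_log_iff hΛ (by positivity), Real.log_inv, Real.log_rpow (by positivity),
    Real.log_rpow hθ0]
  rw [show -(s * (-(1 / (d : ℝ)) * Real.log θ)) = s * Real.log θ / d by ring, lt_div_iff₀ hd0]
  linarith

/-- The points covered by the `n`-th ball at stage `k` if it is retained, and none otherwise. -/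
def retainedBall {T : Type*} [PseudoMetricSpace T] (N : ℕ → ℕ) (r : ℕ → ℝ) (k₀ k n : ℕ)
    (x : ℕ → T) : Set T :=
  {y | x ∈ retained N r k₀ k n ∧ dist (x n) y < r k}

theorem ediam_retainedBall_rpow_le {T : Type*} [PseudoMetricSpace T] {N : ℕ → ℕ} {r : ℕ → ℝ}
    {k₀ k n : ℕ} {s : ℝ} (hs : 0 < s) (hr : 0 ≤ r k) (x : ℕ → T) :
    Metric.ediam (retainedBall N r k₀ k n x) ^ s ≤
      (retained N r k₀ k n).indicator (fun _ => ENNReal.ofReal ((2 * r k) ^ s)) x := by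
  by_cases hx : x ∈ retained N r k₀ k n
  · rw [Set.indicator_of_mem hx, ← ENNReal.ofReal_rpow_of_nonneg (by positivity) hs.le]
    gcongr
    refine Metric.ediam_le fun y hy z hz => ?_
    rw [edist_dist]
    refine ENNReal.ofReal_le_ofReal ?_
    have := dist_triangle_left y z (x n)
    linarith [hy.2, hz.2]
  · have : retainedBall N r k₀ k n x = ∅ := by
      ext y
      simp [retainedBall, hx]
    simp [this, hs]

theorem coveredFrom_subset_iUnion_retainedBall {T : Type*} [PseudoMetricSpace T] {N : ℕ → ℕ}
    {r ℓ : ℕ → ℝ} {p k₀ k : ℕ} (hN : ∀ k, k₀ ≤ k → p ≤ N k) (hℓ : ∀ k, k₀ ≤ k → ℓ (N k) ≤ r k)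
    (hk : k₀ ≤ k) (x : ℕ → T) :
    coveredFrom x ℓ p ⊆ ⋃ n : Fin (N k), retainedBall N r k₀ k n x := by
  intro y hy
  have h : ∀ j, k₀ ≤ j → ∃ m < N j, dist (x m) y < r j := fun j hj => by
    obtain ⟨m, hm, h⟩ := hy (N j) (hN j hj)
    exact ⟨m, hm, h.trans_le (hℓ j hj)⟩
  obtain ⟨n, hn, hny⟩ := h k hk
  exact Set.mem_iUnion.2 ⟨⟨n, hn⟩, ⟨⟨y, hny, fun j hj _ => h j hj⟩, hny⟩⟩

/-- The expected sums `∑ diam ^ s` over the retained balls of the stages form a convergent series,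
so that almost surely the sums themselves tend to zero. -/
theorem ae_hausdorffMeasure_coveredFrom_eq_zero (hd : 1 ≤ d) (hX : ∀ n, Measurable (X n))
    (hind : iIndepFun X P) (hunif : ∀ n, Measure.map (X n) P = volume) (hc : 0 < c) (hθ : 1 < θ)
    {s : ℝ} (hs : upperDimBound d c θ < s) {p : ℕ} :
    ∀ᵐ a ∂P, Measure.hausdorffMeasure s
      (coveredFrom (fun n => X n a) (fun N => c / (N : ℝ) ^ (1 / (d : ℝ))) p) = 0 := by
  have hθ0 : 0 < θ := by linarith
  have hs0 : 0 < s := (upperDimBound_nonneg hc hθ).trans_lt hs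
  obtain ⟨lam, hlam1, hlam2⟩ := exists_between (coveringLambda_lt_of_upperDimBound_lt hd hc hθ hs)
  have hlam0 : 0 < lam := by linarith [one_le_coveringLambda (d := d) hc hθ]
  set u := (θ ^ (-(1 / (d : ℝ)))) ^ s with hu
  have hu0 : 0 < u := by positivity
  have hratio : lam * u < 1 := by
    rwa [← one_div, lt_div_iff₀ hu0] at hlam2
  set N : ℕ → ℕ := fun k => ⌈θ ^ k⌉₊ with hNdef
  set r := scale d c θ with hrdef
  have hr0 := scale_nonneg (d := d) hc.le hθ
  obtain ⟨k₀, ⟨C, hC, hM⟩, hp⟩ :=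
    ((exists_sum_retainedProb_le hd hX hind hunif hc hθ hlam1).and
      ((tendsto_pow_atTop_atTop_of_one_lt hθ).eventually_ge_atTop (p : ℝ))).exists
  have hNp : ∀ k, k₀ ≤ k → p ≤ N k := fun k hk => by
    have h1 : (p : ℝ) ≤ θ ^ k := hp.trans (pow_le_pow_right₀ hθ.le hk)
    exact_mod_cast h1.trans (Nat.le_ceil _)
  have hℓ : ∀ k, k₀ ≤ k → c / ((N k : ℕ) : ℝ) ^ (1 / (d : ℝ)) ≤ r k := fun k _ => by
    have h1 : (θ ^ k) ^ (1 / (d : ℝ)) ≤ ((N k : ℕ) : ℝ) ^ (1 / (d : ℝ)) :=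
      Real.rpow_le_rpow (by positivity) (Nat.le_ceil _) (by positivity)
    rw [hrdef, scale, scale_pow hθ, Real.rpow_neg (by positivity), ← div_eq_mul_inv]
    gcongr
  let E : ℕ → ℕ → Set Ω := fun k n => (fun a i => X i a) ⁻¹' retained N r k₀ k n
  have hE : ∀ k n, MeasurableSet (E k n) := fun k n =>
    (measurable_pi_lambda _ hX) isOpen_retained.measurableSet
  let w : ℕ → ENNReal := fun k => ENNReal.ofReal ((2 * r k) ^ s)
  let g : ℕ → Ω → ENNReal := fun k a =>
    ∑ n ∈ Finset.range (N k), (E k n).indicator (fun _ => w k) a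
  have hgm : ∀ k, Measurable (g k) := fun k =>
    Finset.measurable_fun_sum _ fun n _ => measurable_const.indicator (hE k n)
  have hg : ∀ k, k₀ ≤ k → ∫⁻ a, g k a ∂P ≤ ENNReal.ofReal (C * (2 * c) ^ s * (lam * u) ^ k) := by
    intro k hk
    have e1 : ∫⁻ a, g k a ∂P =
        ENNReal.ofReal ((∑ n ∈ Finset.range (N k), retainedProb P X N r k₀ k n) *
          (2 * r k) ^ s) := by
      have hnn : ∀ n ∈ Finset.range (N k), 0 ≤ retainedProb P X N r k₀ k n * (2 * r k) ^ s :=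
        fun n _ => mul_nonneg measureReal_nonneg
          (Real.rpow_nonneg (mul_nonneg zero_le_two (hr0 k)) _)
      rw [lintegral_finsetSum _ fun n _ => measurable_const.indicator (hE k n), Finset.sum_mul,
        ENNReal.ofReal_sum_of_nonneg hnn]
      refine Finset.sum_congr rfl fun n _ => ?_
      have h0 : 0 ≤ retainedProb P X N r k₀ k n := measureReal_nonneg
      rw [lintegral_indicator_const (hE k n), mul_comm, ENNReal.ofReal_mul h0]
      congr 1
      exact (ENNReal.ofReal_toReal (measure_ne_top _ _)).symm
    have e2 : (2 * r k) ^ s = (2 * c) ^ s * u ^ k := by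
      rw [hrdef, scale, ← mul_assoc, Real.mul_rpow (by positivity) (by positivity), hu,
        Real.rpow_pow_comm (x := θ ^ (-(1 / (d : ℝ)))) (by positivity)]
    rw [e1]
    refine ENNReal.ofReal_le_ofReal ?_
    calc _ ≤ (C * lam ^ k) * (2 * r k) ^ s :=
          mul_le_mul_of_nonneg_right (hM k hk) (Real.rpow_nonneg (mul_nonneg zero_le_two (hr0 k)) _)
      _ = _ := by rw [e2, mul_pow]; ring
  have hsum : ∫⁻ a, ∑' k, g (k₀ + k) a ∂P ≠ ⊤ := by
    rw [lintegral_tsum fun k => (hgm _).aemeasurable]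
    refine ne_top_of_le_ne_top ?_ (ENNReal.tsum_le_tsum fun k => hg (k₀ + k) (by omega))
    have hsm : Summable fun k => C * (2 * c) ^ s * (lam * u) ^ (k₀ + k) := by
      simp only [pow_add]
      exact ((summable_geometric_of_lt_one (by positivity) hratio).mul_left _).mul_left _
    rw [← ENNReal.ofReal_tsum_of_nonneg (fun k => by positivity) hsm]
    exact ENNReal.ofReal_ne_top
  filter_upwards [ae_lt_top (Measurable.tsum fun k => hgm (k₀ + k)) hsum] with a ha
  have hlim := ENNReal.tendsto_atTop_zero_of_tsum_ne_top ha.ne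
  set x : ℕ → UnitAddTorus (Fin d) := fun n => X n a
  have hdiam := Measure.hausdorffMeasure_le_liminf_sum s
    (coveredFrom x (fun N => c / (N : ℝ) ^ (1 / (d : ℝ))) p) (l := atTop)
    (fun k => ENNReal.ofReal (2 * r (k₀ + k)))
    (by
      have h := ((tendsto_scale (c := c) hd hθ).comp (tendsto_add_atTop_nat k₀)).const_mul 2
      have h' := ENNReal.tendsto_ofReal h
      rw [mul_zero, ENNReal.ofReal_zero] at h'
      refine h'.congr fun k => ?_
      simp only [Function.comp, add_comm k k₀]
      rfl)
    (fun k (n : Fin (N (k₀ + k))) => retainedBall N r k₀ (k₀ + k) n x)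
    (Eventually.of_forall fun k n => by
      refine Metric.ediam_le fun y hy z hz => ?_
      rw [edist_dist]
      refine ENNReal.ofReal_le_ofReal ?_
      have := dist_triangle_left y z (x n)
      linarith [hy.2, hz.2])
    (Eventually.of_forall fun k =>
      coveredFrom_subset_iUnion_retainedBall hNp hℓ (by omega) x)
  refine le_antisymm (hdiam.trans ?_) zero_le
  rw [← hlim.liminf_eq]
  refine liminf_le_liminf (Eventually.of_forall fun k => ?_)
  calc ∑ n : Fin (N (k₀ + k)), Metric.ediam (retainedBall N r k₀ (k₀ + k) n x) ^ s
      = ∑ n ∈ Finset.range (N (k₀ + k)),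
          Metric.ediam (retainedBall N r k₀ (k₀ + k) n x) ^ s :=
        Fin.sum_univ_eq_sum_range
          (fun n => Metric.ediam (retainedBall N r k₀ (k₀ + k) n x) ^ s) _
    _ ≤ _ := Finset.sum_le_sum fun n _ => ediam_retainedBall_rpow_le hs0 (hr0 _) x

end UpperBound

/-- The uniform covering set is the countable union of the sets `coveredFrom`. -/
theorem uniformCoveringSet_eq_iUnion {T : Type*} [PseudoMetricSpace T] (x : ℕ+ → T) (d : ℕ)
    (c : ℝ) : uniformCoveringSet x (criticalRadius d c) =
      ⋃ p : ℕ, coveredFrom (fun n => x n.succPNat)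
        (fun N => c / (N : ℝ) ^ (1 / (d : ℝ))) (p + 1) := by
  ext y
  simp only [uniformCoveringSet, coveredFrom, criticalRadius, Set.mem_ofPred_eq, Set.mem_iUnion,
    eventually_atTop]
  constructor
  · rintro ⟨p, hp⟩
    refine ⟨p, fun N hN => ?_⟩
    obtain ⟨N, rfl⟩ : ∃ N' : ℕ+, (N' : ℕ) = N := ⟨⟨N, by omega⟩, rfl⟩
    obtain ⟨n, hn, h⟩ := hp N (PNat.coe_le_coe _ _ |>.1 (by omega))
    have h1 := n.natPred_add_one
    have h2 := (PNat.coe_le_coe _ _).2 hn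
    exact ⟨n.natPred, by omega, by simpa using h⟩
  · rintro ⟨p, hp⟩
    refine ⟨p.succPNat, fun N hN => ?_⟩
    obtain ⟨n, hn, h⟩ := hp N ((PNat.coe_le_coe _ _).2 hN)
    exact ⟨n.succPNat, (PNat.coe_le_coe _ _).1 hn, h⟩

theorem ae_dimH_uniformCoveringSet_le {Ω : Type*} [MeasurableSpace Ω] {P : Measure Ω}
    [IsProbabilityMeasure P] {d : ℕ} (hd : 1 ≤ d) {ω : ℕ+ → Ω → UnitAddTorus (Fin d)}
    (hmeas : ∀ n, Measurable (ω n)) (hindep : iIndepFun ω P)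
    (hunif : ∀ n, Measure.map (ω n) P = (volume : Measure (UnitAddTorus (Fin d))))
    {c θ : ℝ} (hc : 0 < c) (hθ : 1 < θ) :
    ∀ᵐ a ∂P, dimH (uniformCoveringSet (fun n => ω n a) (criticalRadius d c)) ≤
      ENNReal.ofReal (upperDimBound d c θ) := by
  have hX : iIndepFun (fun n : ℕ => ω n.succPNat) P := hindep.precomp Nat.succPNat_injective
  have h : ∀ᵐ a ∂P, ∀ i p : ℕ, Measure.hausdorffMeasure
      (upperDimBound d c θ + 1 / ((i : ℝ) + 1)) (coveredFrom (fun n => ω n.succPNat a)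
        (fun N => c / (N : ℝ) ^ (1 / (d : ℝ))) (p + 1)) = 0 := by
    rw [ae_all_iff]
    intro i
    rw [ae_all_iff]
    intro p
    refine ae_hausdorffMeasure_coveredFrom_eq_zero (X := fun n => ω n.succPNat) hd
      (fun n => hmeas _) hX (fun n => hunif _) hc hθ ?_
    have : 0 < 1 / ((i : ℝ) + 1) := by positivity
    linarith
  filter_upwards [h] with a ha
  rw [uniformCoveringSet_eq_iUnion, dimH_iUnion]
  refine iSup_le fun p => ?_
  have h0 := upperDimBound_nonneg (d := d) hc hθ
  have hlim : Tendsto (fun i : ℕ => ENNReal.ofReal (upperDimBound d c θ + 1 / ((i : ℝ) + 1))) atTop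
      (nhds (ENNReal.ofReal (upperDimBound d c θ))) := by
    have := ENNReal.tendsto_ofReal
      (tendsto_one_div_add_atTop_nhds_zero_nat.const_add (upperDimBound d c θ))
    rwa [add_zero] at this
  refine ge_of_tendsto' hlim fun i => ?_
  refine dimH_le_of_hausdorffMeasure_ne_top ?_
  rw [Real.coe_toNNReal _ (by positivity), ha i p]
  exact ENNReal.zero_ne_top

/-! ### Energy and Hausdorff measure -/

section Energy

variable {T : Type*} [PseudoMetricSpace T]

/-- A discretised Riesz kernel: the sum of the weights `(w j)⁻¹` over the scales `2 ρ j` that are at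
least the distance of the two points. -/
noncomputable def scaleKernel (ρ : ℕ → ℝ) (w : ℕ → ENNReal) (p : T × T) : ENNReal :=
  ∑' j, {p : T × T | dist p.1 p.2 ≤ 2 * ρ j}.indicator (fun _ => (w j)⁻¹) p

theorem le_scaleKernel {ρ : ℕ → ℝ} {w : ℕ → ENNReal} {j : ℕ} {p : T × T}
    (hp : dist p.1 p.2 ≤ 2 * ρ j) : (w j)⁻¹ ≤ scaleKernel ρ w p := by
  refine le_trans ?_ (ENNReal.le_tsum j)
  rw [Set.indicator_of_mem (show p ∈ {p : T × T | dist p.1 p.2 ≤ 2 * ρ j} from hp)]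

theorem ENNReal.le_add_mul_self_div {x p : ENNReal} (hp : p ≠ 0) (hp' : p ≠ ⊤) :
    x ≤ p + x * x / p := by
  rcases le_total x p with h | h
  · exact h.trans le_self_add
  · refine le_trans ?_ le_add_self
    rw [mul_div_assoc]
    calc x = x * 1 := (mul_one x).symm
      _ ≤ x * (x / p) := by
        gcongr
        rw [ENNReal.le_div_iff_mul_le (Or.inl hp) (Or.inl hp'), one_mul]
        exact h

variable [MeasurableSpace T] [OpensMeasurableSpace T]

/-- A measure carried by a union of balls of radii `ρ (j n)` has large energy, or large
`∑ w (j n)`. This is the Cauchy-Schwarz inequality with a free parameter `A`. -/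
theorem measure_univ_le_energy [SecondCountableTopology T] {ρ : ℕ → ℝ} {w : ℕ → ENNReal}
    (hw : ∀ j, w j ≠ 0) (hw' : ∀ j, w j ≠ ⊤) (μ : Measure T) [SFinite μ] {x : ℕ → T} {j : ℕ → ℕ}
    (hcov : μ (⋃ n, Metric.ball (x n) (ρ (j n)))ᶜ = 0) {A : ENNReal} (hA : A ≠ 0) (hA' : A ≠ ⊤) :
    μ Set.univ ≤ A * ∑' n, w (j n) + (∫⁻ p, scaleKernel ρ w p ∂(μ.prod μ)) / A := by
  let V : ℕ → Set T := fun n => Metric.ball (x n) (ρ (j n))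
  let W : ℕ → Set T := disjointed V
  have hV : ∀ n, MeasurableSet (V n) := fun n => Metric.isOpen_ball.measurableSet
  have hW : ∀ n, MeasurableSet (W n) := MeasurableSet.disjointed hV
  have hWd : Pairwise (Function.onFun Disjoint W) := disjoint_disjointed V
  have hWW : Pairwise (Function.onFun Disjoint fun n => W n ×ˢ W n) := fun m n hmn =>
    Set.disjoint_prod.2 (Or.inl (hWd hmn))
  have henergy : ∑' n, (w (j n))⁻¹ * (μ (W n) * μ (W n)) ≤
      ∫⁻ p, scaleKernel ρ w p ∂(μ.prod μ) := by
    calc ∑' n, (w (j n))⁻¹ * (μ (W n) * μ (W n))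
        ≤ ∑' n, ∫⁻ p in W n ×ˢ W n, scaleKernel ρ w p ∂(μ.prod μ) := by
          refine ENNReal.tsum_le_tsum fun n => ?_
          rw [← Measure.prod_prod, ← setLIntegral_const]
          refine setLIntegral_mono' ((hW n).prod (hW n)) fun p hp => le_scaleKernel ?_
          have h1 : dist p.1 (x n) < ρ (j n) := disjointed_subset V n hp.1
          have h2 : dist p.2 (x n) < ρ (j n) := disjointed_subset V n hp.2
          linarith [dist_triangle_right p.1 p.2 (x n)]
      _ = ∫⁻ p in ⋃ n, W n ×ˢ W n, scaleKernel ρ w p ∂(μ.prod μ) :=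
          (lintegral_iUnion (fun n => (hW n).prod (hW n)) hWW _).symm
      _ ≤ _ := setLIntegral_le_lintegral _ _
  calc μ Set.univ ≤ μ (⋃ n, V n) + μ (⋃ n, V n)ᶜ := by
        rw [← Set.union_compl_self (⋃ n, V n)]; exact measure_union_le _ _
    _ = ∑' n, μ (W n) := by
        rw [hcov, add_zero, ← iUnion_disjointed, measure_iUnion hWd hW]
    _ ≤ ∑' n, (A * w (j n) + (w (j n))⁻¹ * (μ (W n) * μ (W n)) / A) := by
        refine ENNReal.tsum_le_tsum fun n => ?_
        refine (ENNReal.le_add_mul_self_div (mul_ne_zero hA (hw (j n)))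
          (ENNReal.mul_ne_top hA' (hw' (j n)))).trans (add_le_add le_rfl (le_of_eq ?_))
        rw [div_eq_mul_inv, div_eq_mul_inv, ENNReal.mul_inv (Or.inl hA) (Or.inl hA')]
        ring
    _ = A * ∑' n, w (j n) + (∑' n, (w (j n))⁻¹ * (μ (W n) * μ (W n))) / A := by
        simp only [div_eq_mul_inv]
        rw [ENNReal.tsum_add, ENNReal.tsum_mul_left, ENNReal.tsum_mul_right]
    _ ≤ _ := by gcongr

end Energy

section Cover

variable {T : Type*} [MetricSpace T] [MeasurableSpace T] [BorelSpace T]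

/-- Rounding a diameter up to the next scale of a geometric sequence. -/
theorem exists_scale_gt {R v t D η : ℝ} (hR : 0 < R) (hv : 0 < v) (hv1 : v < 1) (ht : 0 < t)
    (hD : 0 ≤ D) (hDR : D < R) (hη : 0 < η) :
    ∃ j : ℕ, D < R * v ^ j ∧ (v ^ t) ^ j ≤ ((R * v)⁻¹) ^ t * D ^ t + η := by
  rcases hD.eq_or_lt with rfl | hD
  · obtain ⟨j, hj⟩ := exists_pow_lt_of_lt_one hη (Real.rpow_lt_one hv.le hv1 ht)
    refine ⟨j, by positivity, hj.le.trans ?_⟩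
    rw [Real.zero_rpow ht.ne']
    simp
  · have h1 : 0 < D / R := by positivity
    have h2 : D / R < 1 := by rwa [div_lt_one hR]
    obtain ⟨j, hj1, hj2⟩ := exists_nat_pow_near_of_lt_one h1 h2.le hv hv1
    rcases hj2.eq_or_lt with heq | hlt
    · rcases j with _ | j
      · simp [heq] at h2
      · refine ⟨j, ?_, ?_⟩
        · rw [div_eq_iff hR.ne'] at heq
          rw [heq, mul_comm]
          exact mul_lt_mul_of_pos_left (pow_lt_pow_right_of_lt_one₀ hv hv1 (Nat.lt_succ_self j)) hR
        · rw [Real.rpow_pow_comm hv.le, ← Real.mul_rpow (by positivity) hD.le]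
          have : v ^ j ≤ (R * v)⁻¹ * D := by
            rw [mul_inv, mul_right_comm, ← div_eq_inv_mul, heq, pow_succ, mul_assoc,
              mul_inv_cancel₀ hv.ne', mul_one]
          have := Real.rpow_le_rpow (by positivity) this ht.le
          linarith
    · refine ⟨j, ?_, ?_⟩
      · rwa [div_lt_iff₀' hR] at hlt
      · rw [Real.rpow_pow_comm hv.le, ← Real.mul_rpow (by positivity) hD.le]
        have : v ^ j ≤ (R * v)⁻¹ * D := by
          rw [mul_inv, mul_right_comm, ← div_eq_inv_mul, ← div_eq_mul_inv, le_div_iff₀ hv,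
            ← pow_succ]
          exact hj1.le
        have := Real.rpow_le_rpow (by positivity) this ht.le
        linarith

/-- A set of vanishing Hausdorff measure has economical covers by balls whose radii belong to a
given geometric sequence. -/
theorem exists_cover_of_hausdorffMeasure_eq_zero [Nonempty T] {E : Set T} {R v t : ℝ} (hR : 0 < R)
    (hv : 0 < v) (hv1 : v < 1) (ht : 0 < t) (hE : Measure.hausdorffMeasure t E = 0) {δ : ENNReal}
    (hδ : δ ≠ 0) : ∃ (x : ℕ → T) (j : ℕ → ℕ), E ⊆ ⋃ n, Metric.ball (x n) (R * v ^ j n) ∧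
      ∑' n, ENNReal.ofReal (v ^ t) ^ j n < δ := by
  set L : ENNReal := ENNReal.ofReal (((R * v)⁻¹) ^ t) with hL
  have hL0 : L ≠ 0 := by
    rw [hL, Ne, ENNReal.ofReal_eq_zero, not_le]; positivity
  have hδ2 : δ / 2 ≠ 0 := (ENNReal.half_pos hδ).ne'
  obtain ⟨η, hη, hηsum⟩ := ENNReal.exists_pos_sum_of_countable hδ2 ℕ
  rw [Measure.hausdorffMeasure_apply] at hE
  have hr : 0 < ENNReal.ofReal (R / 2) := by rw [ENNReal.ofReal_pos]; positivity
  have h1 := ENNReal.iSup_eq_zero.1 (ENNReal.iSup_eq_zero.1 hE (ENNReal.ofReal (R / 2))) hr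
  have h2 : (0 : ENNReal) < (δ / 2) / L := ENNReal.div_pos hδ2 ENNReal.ofReal_ne_top
  rw [← h1] at h2
  simp only [iInf_lt_iff] at h2
  obtain ⟨s, hs, hsr, hsum⟩ := h2
  have hfin : ∀ n, Metric.ediam (s n) ≠ ⊤ := fun n =>
    ne_top_of_le_ne_top ENNReal.ofReal_ne_top (hsr n)
  have hchoice : ∀ n, ∃ (x : T) (j : ℕ), s n ⊆ Metric.ball x (R * v ^ j) ∧
      ENNReal.ofReal (v ^ t) ^ j ≤ L * (⨆ _ : (s n).Nonempty, Metric.ediam (s n) ^ t) + η n := by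
    intro n
    have hηn : (0 : ℝ) < η n := hη n
    rcases (s n).eq_empty_or_nonempty with he | hne
    · obtain ⟨j, -, hj⟩ := exists_scale_gt (D := 0) hR hv hv1 ht le_rfl hR hηn
      refine ⟨Classical.arbitrary T, j, by simp [he], ?_⟩
      refine le_trans ?_ le_add_self
      rw [← ENNReal.ofReal_pow (by positivity), ← ENNReal.ofReal_coe_nnreal]
      refine ENNReal.ofReal_le_ofReal (hj.trans (le_of_eq ?_))
      rw [Real.zero_rpow ht.ne']; simp
    · obtain ⟨x, hx⟩ := hne
      have hD : (Metric.ediam (s n)).toReal ≤ R / 2 := by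
        rw [← ENNReal.toReal_ofReal (show 0 ≤ R / 2 by positivity)]
        exact ENNReal.toReal_mono ENNReal.ofReal_ne_top (hsr n)
      obtain ⟨j, hj1, hj2⟩ := exists_scale_gt hR hv hv1 ht ENNReal.toReal_nonneg
        (lt_of_le_of_lt hD (by linarith)) hηn
      refine ⟨x, j, fun y hy => ?_, ?_⟩
      · rw [Metric.mem_ball]
        refine lt_of_le_of_lt ?_ hj1
        rw [dist_edist]
        exact ENNReal.toReal_mono (hfin n) (Metric.edist_le_ediam_of_mem hy hx)
      · rw [ciSup_pos ⟨x, hx⟩, ← ENNReal.ofReal_pow (by positivity)]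
        refine (ENNReal.ofReal_le_ofReal hj2).trans ?_
        rw [ENNReal.ofReal_add (by positivity) hηn.le, ENNReal.ofReal_coe_nnreal,
          ENNReal.ofReal_mul (by positivity),
          ← ENNReal.ofReal_rpow_of_nonneg ENNReal.toReal_nonneg ht.le,
          ENNReal.ofReal_toReal (hfin n)]
  choose x j hsub hle using hchoice
  refine ⟨x, j, hs.trans (Set.iUnion_mono hsub), ?_⟩
  calc ∑' n, ENNReal.ofReal (v ^ t) ^ j n
      ≤ ∑' n, (L * (⨆ _ : (s n).Nonempty, Metric.ediam (s n) ^ t) + η n) :=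
        ENNReal.tsum_le_tsum hle
    _ = L * ∑' n, (⨆ _ : (s n).Nonempty, Metric.ediam (s n) ^ t) + ∑' n, (η n : ENNReal) := by
        rw [ENNReal.tsum_add, ENNReal.tsum_mul_left]
    _ < δ / 2 + δ / 2 := by
        refine ENNReal.add_lt_add ?_ hηsum
        rw [mul_comm]
        exact (ENNReal.lt_div_iff_mul_lt (Or.inl hL0) (Or.inl ENNReal.ofReal_ne_top)).1 hsum
    _ = δ := ENNReal.add_halves δ

/-- Let `F K` be decreasing closed sets in a compact space. If infinitely many of them carry a
measure of mass at least `1 / 2` and energy at most `C`, then the intersection has positive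
Hausdorff measure. No limit of the measures is needed: by compactness a cover of the intersection
covers some `F K`. -/
theorem hausdorffMeasure_iInter_ne_zero [CompactSpace T] [Nonempty T] {F : ℕ → Set T}
    (hF : ∀ K, IsClosed (F K)) (hanti : Antitone F) {R v t : ℝ} (hR : 0 < R) (hv : 0 < v)
    (hv1 : v < 1) (ht : 0 < t) {C : ENNReal} (hC : C ≠ 0) (hC' : C ≠ ⊤) {μ : ℕ → Measure T}
    [∀ K, SFinite (μ K)] (hμF : ∀ K, μ K (F K)ᶜ = 0)
    (hμ : ∃ᶠ K in atTop, 1 / 2 ≤ μ K Set.univ ∧ ∫⁻ p, scaleKernel (fun j => R * v ^ j)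
      (fun j => ENNReal.ofReal (v ^ t) ^ j) p ∂((μ K).prod (μ K)) ≤ C) :
    Measure.hausdorffMeasure t (⋂ K, F K) ≠ 0 := by
  intro h0
  have hw0 : ENNReal.ofReal (v ^ t) ≠ 0 := by
    rw [Ne, ENNReal.ofReal_eq_zero, not_le]; positivity
  have h4 : (4 : ENNReal) * C ≠ 0 := mul_ne_zero (by norm_num) hC
  have h4' : (4 : ENNReal) * C ≠ ⊤ := ENNReal.mul_ne_top (by norm_num) hC'
  obtain ⟨x, j, hcov, hsum⟩ := exists_cover_of_hausdorffMeasure_eq_zero hR hv hv1 ht h0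
    (δ := 1 / 4 / (4 * C)) (ENNReal.div_pos (by norm_num) h4').ne'
  have hopen : IsOpen (⋃ n, Metric.ball (x n) (R * v ^ j n)) :=
    isOpen_iUnion fun n => Metric.isOpen_ball
  obtain ⟨K₀, hK₀⟩ := exists_subset_nhds_of_isCompact' (hanti.directed_ge)
    (fun K => (hF K).isCompact) hF (fun y hy => hopen.mem_nhds (hcov hy))
  obtain ⟨K, hK, hmass, hen⟩ := (Filter.frequently_atTop.1 hμ) K₀
  have hnull : μ K (⋃ n, Metric.ball (x n) (R * v ^ j n))ᶜ = 0 :=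
    measure_mono_null (Set.compl_subset_compl.2 ((hanti hK).trans hK₀)) (hμF K)
  have hle := measure_univ_le_energy (ρ := fun j => R * v ^ j)
    (w := fun j => ENNReal.ofReal (v ^ t) ^ j) (fun j => pow_ne_zero _ hw0)
    (fun j => ENNReal.pow_ne_top ENNReal.ofReal_ne_top) (μ K) hnull h4 h4'
  have hlt : 4 * C * ∑' n, ENNReal.ofReal (v ^ t) ^ j n < 1 / 4 := by
    rw [mul_comm]
    exact (ENNReal.lt_div_iff_mul_lt (Or.inl h4) (Or.inl h4')).1 hsum
  have hen4 : (∫⁻ p, scaleKernel (fun j => R * v ^ j)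
      (fun j => ENNReal.ofReal (v ^ t) ^ j) p ∂((μ K).prod (μ K))) / (4 * C) ≤ 1 / 4 := by
    refine (ENNReal.div_le_div_right hen _).trans ?_
    rw [ENNReal.div_le_iff h4 h4', ← mul_assoc, one_div, ENNReal.inv_mul_cancel (by norm_num)
      (by norm_num), one_mul]
  have hfinal : (1 / 2 : ENNReal) < 1 / 4 + 1 / 4 :=
    (hmass.trans hle).trans_lt (ENNReal.add_lt_add_of_lt_of_le
      (ne_top_of_le_ne_top (by finiteness) hen4) hlt hen4)
  have : (1 / 4 + 1 / 4 : ENNReal) = 1 / 2 := by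
    rw [← ENNReal.toReal_eq_toReal_iff' (by finiteness) (by finiteness),
      ENNReal.toReal_add (by finiteness) (by finiteness)]
    norm_num
  exact absurd hfinal (by rw [this]; exact lt_irrefl _)

end Cover

/-! ### Points hit by every block -/

section Hit

variable {T : Type*} [PseudoMetricSpace T]

/-- The points within `ρ i` of one of the points of the `i`-th block `N i ≤ n < N (i + 1)`. -/
def hitSet (N : ℕ → ℕ) (ρ : ℕ → ℝ) (i : ℕ) (x : ℕ → T) : Set T :=
  ⋃ n ∈ Finset.Ico (N i) (N (i + 1)), Metric.closedBall (x n) (ρ i)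

/-- The points hit by each of the first `K` blocks. -/
def hitUpTo (N : ℕ → ℕ) (ρ : ℕ → ℝ) (K : ℕ) (x : ℕ → T) : Set T :=
  ⋂ i ∈ Finset.range K, hitSet N ρ i x

variable {N : ℕ → ℕ} {ρ : ℕ → ℝ}

theorem mem_hitSet {i : ℕ} {x : ℕ → T} {y : T} :
    y ∈ hitSet N ρ i x ↔ ∃ n ∈ Finset.Ico (N i) (N (i + 1)), x n ∈ Metric.closedBall y (ρ i) := by
  simp only [hitSet, Set.mem_iUnion, Metric.mem_closedBall, exists_prop, dist_comm y]

theorem isClosed_hitUpTo (K : ℕ) (x : ℕ → T) : IsClosed (hitUpTo N ρ K x) :=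
  isClosed_biInter fun _ _ => isClosed_biUnion_finset fun _ _ => Metric.isClosed_closedBall

theorem hitUpTo_antitone (x : ℕ → T) : Antitone fun K => hitUpTo N ρ K x := fun _ _ h =>
  Set.biInter_mono (Finset.coe_subset.2 (Finset.range_mono h)) fun _ _ => subset_rfl

theorem measurableSet_mem_hitUpTo {Ω : Type*} [MeasurableSpace Ω] [MeasurableSpace T]
    [OpensMeasurableSpace T] [SecondCountableTopology T] {X : ℕ → Ω → T}
    (hX : ∀ n, Measurable (X n)) (K : ℕ) :
    MeasurableSet {p : Ω × T | p.2 ∈ hitUpTo N ρ K (fun n => X n p.1)} := by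
  have h : {p : Ω × T | p.2 ∈ hitUpTo N ρ K (fun n => X n p.1)} = ⋂ i ∈ Finset.range K,
      ⋃ n ∈ Finset.Ico (N i) (N (i + 1)), {p : Ω × T | dist p.2 (X n p.1) ≤ ρ i} := by
    ext p
    simp [hitUpTo, hitSet]
  rw [h]
  exact Finset.measurableSet_biInter _ fun i _ => Finset.measurableSet_biUnion _ fun n _ =>
    measurableSet_le (measurable_snd.dist ((hX n).comp measurable_fst)) measurable_const

end Hit

section HitProbability

variable {Ω : Type*} [mΩ : MeasurableSpace Ω] {P : Measure Ω} {T : Type*}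
  [mT : MeasurableSpace T] {X : ℕ → Ω → T} {N : ℕ → ℕ}

/-- Events that depend on disjoint blocks of an independent sequence are independent. -/
theorem measure_biInter_blocks (hX : ∀ n, Measurable (X n)) (hind : iIndepFun X P)
    (hN : Monotone N) {D : ℕ → Set Ω}
    (hD : ∀ i, MeasurableSet[⨆ n ∈ Set.Ico (N i) (N (i + 1)), mT.comap (X n)] (D i)) (K : ℕ) :
    P (⋂ i ∈ Finset.range K, D i) = ∏ i ∈ Finset.range K, P (D i) := by
  have : IsProbabilityMeasure P := hind.isProbabilityMeasure
  induction K with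
  | zero => simp
  | succ K ih =>
    have hdisj : Disjoint (Set.Iio (N K)) (Set.Ico (N K) (N (K + 1))) := by
      rw [Set.disjoint_left]
      intro n h1 h2
      exact absurd h2.1 (not_le.2 h1)
    have h := indep_iSup_of_disjoint (fun n => (hX n).comap_le) hind.iIndep hdisj
    rw [Indep_iff] at h
    rw [Finset.prod_range_succ, ← ih, Finset.range_add_one, Finset.set_biInter_insert,
      Set.inter_comm]
    refine h _ _ ?_ (hD K)
    refine Finset.measurableSet_biInter _ fun i hi => ?_
    refine (biSup_mono fun n hn => ?_ : (⨆ n ∈ Set.Ico (N i) (N (i + 1)), mT.comap (X n)) ≤ _) _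
      (hD i)
    exact hn.2.trans_le (hN (Finset.mem_range.1 hi))

theorem measureReal_forall_notMem [IsProbabilityMeasure P] (hX : ∀ n, Measurable (X n))
    (hind : iIndepFun X P) {ν : Measure T} (hunif : ∀ n, Measure.map (X n) P = ν) {G : Set T}
    (hG : MeasurableSet G) (S : Finset ℕ) :
    P.real {a | ∀ n ∈ S, X n a ∉ G} = (1 - ν.real G) ^ S.card := by
  have e : {a | ∀ n ∈ S, X n a ∉ G} = ⋂ n ∈ S, X n ⁻¹' Gᶜ := by ext a; simp
  have h1 : ∀ n, P.real (X n ⁻¹' Gᶜ) = 1 - ν.real G := fun n => by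
    rw [Set.preimage_compl, probReal_compl_eq_one_sub (hX n hG), measureReal_def, measureReal_def,
      ← hunif n, Measure.map_apply (hX n) hG]
  rw [e, measureReal_def, hind.meas_biInter fun n _ => ⟨Gᶜ, hG.compl, rfl⟩, ENNReal.toReal_prod]
  simp only [← measureReal_def, h1, Finset.prod_const]

end HitProbability

section HitEvent

variable {Ω : Type*} {d : ℕ} {X : ℕ → Ω → UnitAddTorus (Fin d)} {N : ℕ → ℕ} {ρ : ℕ → ℝ}

theorem measurableSet_mem_hitSet (i : ℕ) (y : UnitAddTorus (Fin d)) :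
    MeasurableSet[⨆ n ∈ Set.Ico (N i) (N (i + 1)), MeasurableSpace.comap (X n) inferInstance]
      {a | y ∈ hitSet N ρ i (fun n => X n a)} := by
  have e : {a | y ∈ hitSet N ρ i (fun n => X n a)} =
      ⋃ n ∈ Finset.Ico (N i) (N (i + 1)), X n ⁻¹' Metric.closedBall y (ρ i) := by
    ext a
    simp only [Set.mem_ofPred_eq, mem_hitSet, Set.mem_iUnion, Set.mem_preimage, exists_prop]
  rw [e]
  refine Finset.measurableSet_biUnion _ fun n hn => ?_
  refine (le_biSup (fun n => MeasurableSpace.comap (X n) inferInstance)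
    (Set.mem_Ico.2 (Finset.mem_Ico.1 hn))) _ ?_
  exact ⟨_, Metric.isClosed_closedBall.measurableSet, rfl⟩

theorem compl_mem_hitSet (i : ℕ) (y : UnitAddTorus (Fin d)) :
    {a | y ∈ hitSet N ρ i (fun n => X n a)}ᶜ =
      {a | ∀ n ∈ Finset.Ico (N i) (N (i + 1)), X n a ∉ Metric.closedBall y (ρ i)} := by
  ext a
  simp only [Set.mem_compl_iff, Set.mem_ofPred_eq, mem_hitSet, not_exists, not_and]

end HitEvent

section HitTorus

variable {Ω : Type*} [mΩ : MeasurableSpace Ω] {P : Measure Ω} [IsProbabilityMeasure P] {d : ℕ}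
  {X : ℕ → Ω → UnitAddTorus (Fin d)} {N : ℕ → ℕ} {ρ : ℕ → ℝ}

/-- The probability that a given point is hit by the `i`-th block. -/
noncomputable def hitProb (d : ℕ) (N : ℕ → ℕ) (ρ : ℕ → ℝ) (i : ℕ) : ℝ :=
  1 - (1 - (2 * ρ i) ^ d) ^ (N (i + 1) - N i)

theorem UnitAddTorus.measureReal_closedBall {r : ℝ} (hr : 0 ≤ r) (hr' : 2 * r ≤ 1)
    (y : UnitAddTorus (Fin d)) : (volume : Measure _).real (Metric.closedBall y r) =
      (2 * r) ^ d := by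
  rw [measureReal_def, UnitAddTorus.volume_closedBall_eq y hr hr',
    ENNReal.toReal_ofReal (by positivity)]

theorem measurableSet_mem_hitSet' (hX : ∀ n, Measurable (X n)) (i : ℕ)
    (y : UnitAddTorus (Fin d)) : MeasurableSet {a | y ∈ hitSet N ρ i (fun n => X n a)} :=
  (iSup₂_le fun n _ => (hX n).comap_le : (⨆ n ∈ Set.Ico (N i) (N (i + 1)),
    MeasurableSpace.comap (X n) inferInstance) ≤ mΩ) _ (measurableSet_mem_hitSet i y)

theorem measureReal_mem_hitSet (hX : ∀ n, Measurable (X n)) (hind : iIndepFun X P)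
    (hunif : ∀ n, Measure.map (X n) P = volume) (hρ : ∀ i, 0 ≤ ρ i) (hρ' : ∀ i, 2 * ρ i ≤ 1)
    (i : ℕ) (y : UnitAddTorus (Fin d)) :
    P.real {a | y ∈ hitSet N ρ i (fun n => X n a)} = hitProb d N ρ i := by
  have h := probReal_compl_eq_one_sub (μ := P)
    (measurableSet_mem_hitSet' (N := N) (ρ := ρ) hX i y)
  rw [compl_mem_hitSet, measureReal_forall_notMem hX hind hunif
    Metric.isClosed_closedBall.measurableSet, Nat.card_Ico,
    UnitAddTorus.measureReal_closedBall (hρ i) (hρ' i)] at h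
  unfold hitProb
  linarith

/-- Two points at distance more than `2 ρ i` are hit by the `i`-th block in a negatively correlated
way. -/
theorem measureReal_mem_hitSet_inter_le (hX : ∀ n, Measurable (X n)) (hind : iIndepFun X P)
    (hunif : ∀ n, Measure.map (X n) P = volume) (hρ : ∀ i, 0 ≤ ρ i) (hρ' : ∀ i, 2 * ρ i ≤ 1)
    (i : ℕ) {y z : UnitAddTorus (Fin d)} (hyz : 2 * ρ i < dist y z) :
    P.real ({a | y ∈ hitSet N ρ i (fun n => X n a)} ∩ {a | z ∈ hitSet N ρ i (fun n => X n a)}) ≤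
      hitProb d N ρ i ^ 2 := by
  have hy := measureReal_mem_hitSet (N := N) hX hind hunif hρ hρ' i y
  have hz := measureReal_mem_hitSet (N := N) hX hind hunif hρ hρ' i z
  have hmy := measurableSet_mem_hitSet' (N := N) (ρ := ρ) hX i y
  have hmz := measurableSet_mem_hitSet' (N := N) (ρ := ρ) hX i z
  have hU := measureReal_union_add_inter (μ := P)
    (s := {a | y ∈ hitSet N ρ i (fun n => X n a)}) hmz (measure_ne_top _ _) (measure_ne_top _ _)
  have hc := probReal_compl_eq_one_sub (μ := P) (hmy.union hmz)
  have hdisj : Disjoint (Metric.closedBall y (ρ i)) (Metric.closedBall z (ρ i)) :=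
    Metric.closedBall_disjoint_closedBall (by linarith)
  have hvol : (volume : Measure (UnitAddTorus (Fin d))).real
      (Metric.closedBall y (ρ i) ∪ Metric.closedBall z (ρ i)) = 2 * (2 * ρ i) ^ d := by
    rw [measureReal_union hdisj Metric.isClosed_closedBall.measurableSet,
      UnitAddTorus.measureReal_closedBall (hρ i) (hρ' i),
      UnitAddTorus.measureReal_closedBall (hρ i) (hρ' i)]
    ring
  have hmiss : P.real ({a | y ∈ hitSet N ρ i (fun n => X n a)} ∪
      {a | z ∈ hitSet N ρ i (fun n => X n a)})ᶜ =
      (1 - 2 * (2 * ρ i) ^ d) ^ (N (i + 1) - N i) := by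
    rw [← hvol, ← Nat.card_Ico, ← measureReal_forall_notMem hX hind hunif
      (Metric.isClosed_closedBall.measurableSet.union Metric.isClosed_closedBall.measurableSet),
      Set.compl_union, compl_mem_hitSet, compl_mem_hitSet]
    congr 1
    ext a
    simp only [Set.mem_inter_iff, Set.mem_ofPred_eq, Set.mem_union, not_or]
    exact ⟨fun h n hn => ⟨h.1 n hn, h.2 n hn⟩,
      fun h => ⟨fun n hn => (h n hn).1, fun n hn => (h n hn).2⟩⟩
  have : IsProbabilityMeasure (volume : Measure (UnitAddTorus (Fin d))) :=
    hunif 0 ▸ Measure.isProbabilityMeasure_map (hX 0).aemeasurable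
  have hle1 : 2 * (2 * ρ i) ^ d ≤ 1 := hvol ▸ measureReal_le_one
  -- `1 - 2 V ≤ (1 - V) ^ 2`
  have hpow : (1 - 2 * (2 * ρ i) ^ d) ^ (N (i + 1) - N i) ≤
      ((1 - (2 * ρ i) ^ d) ^ (N (i + 1) - N i)) ^ 2 := by
    rw [← pow_mul, mul_comm (N (i + 1) - N i) 2, pow_mul]
    refine pow_le_pow_left₀ (by linarith) ?_ _
    nlinarith [sq_nonneg ((2 * ρ i) ^ d)]
  unfold hitProb at *
  rw [hy, hz] at hU
  nlinarith

/-- Number of the first `K` scales that do not separate the two points. -/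
noncomputable def closeScales {T : Type*} [PseudoMetricSpace T] (ρ : ℕ → ℝ) (K : ℕ) (p : T × T) :
    ℕ :=
  open Classical in ((Finset.range K).filter fun i => dist p.1 p.2 ≤ 2 * ρ i).card

theorem measure_mem_hitUpTo (hX : ∀ n, Measurable (X n)) (hind : iIndepFun X P)
    (hunif : ∀ n, Measure.map (X n) P = volume) (hN : Monotone N) (hρ : ∀ i, 0 ≤ ρ i)
    (hρ' : ∀ i, 2 * ρ i ≤ 1) (K : ℕ) (y : UnitAddTorus (Fin d)) :
    P {a | y ∈ hitUpTo N ρ K (fun n => X n a)} =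
      ENNReal.ofReal (∏ i ∈ Finset.range K, hitProb d N ρ i) := by
  have e : {a | y ∈ hitUpTo N ρ K (fun n => X n a)} =
      ⋂ i ∈ Finset.range K, {a | y ∈ hitSet N ρ i (fun n => X n a)} := by
    ext a; simp [hitUpTo]
  rw [e, measure_biInter_blocks hX hind hN fun i => measurableSet_mem_hitSet i y,
    ENNReal.ofReal_prod_of_nonneg fun i _ => by
      rw [← measureReal_mem_hitSet hX hind hunif hρ hρ' i y]; exact measureReal_nonneg]
  refine Finset.prod_congr rfl fun i _ => ?_
  rw [← measureReal_mem_hitSet hX hind hunif hρ hρ' i y]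
  exact (ENNReal.ofReal_toReal (measure_ne_top _ _)).symm

/-- Up to a factor `Q` for each scale that does not separate the two points, the events that they
are hit by the first `K` blocks are at most as likely jointly as if they were independent. -/
theorem measure_mem_hitUpTo_inter_le (hX : ∀ n, Measurable (X n)) (hind : iIndepFun X P)
    (hunif : ∀ n, Measure.map (X n) P = volume) (hN : Monotone N) (hρ : ∀ i, 0 ≤ ρ i)
    (hρ' : ∀ i, 2 * ρ i ≤ 1) {Q : ℝ} (hQ : 0 < Q) (hQq : ∀ i, 1 ≤ Q * hitProb d N ρ i) (K : ℕ)
    (p : UnitAddTorus (Fin d) × UnitAddTorus (Fin d)) :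
    P {a | p.1 ∈ hitUpTo N ρ K (fun n => X n a) ∧ p.2 ∈ hitUpTo N ρ K (fun n => X n a)} ≤
      ENNReal.ofReal ((∏ i ∈ Finset.range K, hitProb d N ρ i) ^ 2) *
        ENNReal.ofReal Q ^ closeScales ρ K p := by
  classical
  have hq : ∀ i, 0 < hitProb d N ρ i := fun i => by
    by_contra h
    have := hQq i
    nlinarith [mul_nonneg hQ.le (neg_nonneg.2 (not_lt.1 h))]
  have e : {a | p.1 ∈ hitUpTo N ρ K (fun n => X n a) ∧ p.2 ∈ hitUpTo N ρ K (fun n => X n a)} =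
      ⋂ i ∈ Finset.range K, ({a | p.1 ∈ hitSet N ρ i (fun n => X n a)} ∩
        {a | p.2 ∈ hitSet N ρ i (fun n => X n a)}) := by
    ext a
    simp only [hitUpTo, Set.mem_iInter, Set.mem_inter_iff, Set.mem_ofPred_eq]
    exact ⟨fun h i hi => ⟨h.1 i hi, h.2 i hi⟩,
      fun h => ⟨fun i hi => (h i hi).1, fun i hi => (h i hi).2⟩⟩
  rw [e, measure_biInter_blocks hX hind hN fun i =>
    (measurableSet_mem_hitSet i p.1).inter (measurableSet_mem_hitSet i p.2),
    ← ENNReal.ofReal_pow hQ.le, ← ENNReal.ofReal_mul (by positivity), ← Finset.prod_pow,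
    closeScales, ← Finset.prod_const, Finset.prod_filter, ← Finset.prod_mul_distrib,
    ENNReal.ofReal_prod_of_nonneg fun i _ => by split_ifs <;> positivity]
  refine Finset.prod_le_prod' fun i _ => ?_
  rw [← ENNReal.ofReal_toReal (measure_ne_top P _)]
  refine ENNReal.ofReal_le_ofReal ?_
  split_ifs with h
  · calc _ ≤ P.real {a | p.1 ∈ hitSet N ρ i (fun n => X n a)} :=
          measureReal_mono Set.inter_subset_left (measure_ne_top _ _)
      _ = hitProb d N ρ i * 1 := by
          rw [measureReal_mem_hitSet hX hind hunif hρ hρ' i p.1, mul_one]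
      _ ≤ hitProb d N ρ i * (Q * hitProb d N ρ i) := by
          gcongr
          · exact (hq i).le
          · exact hQq i
      _ = _ := by ring
  · rw [mul_one]
    exact measureReal_mem_hitSet_inter_le hX hind hunif hρ hρ' i (not_le.1 h)

end HitTorus

/-! ### Second moments -/

section Integrals

variable {d : ℕ}

theorem measurableSet_dist_le {T : Type*} [PseudoMetricSpace T] [MeasurableSpace T]
    [OpensMeasurableSpace T] [SecondCountableTopology T] (r : ℝ) :
    MeasurableSet {p : T × T | dist p.1 p.2 ≤ r} :=
  measurableSet_le (measurable_fst.dist measurable_snd) measurable_const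

theorem measurable_scaleKernel {T : Type*} [PseudoMetricSpace T] [MeasurableSpace T]
    [OpensMeasurableSpace T] [SecondCountableTopology T] (ρ : ℕ → ℝ) (w : ℕ → ENNReal) :
    Measurable (scaleKernel ρ w : T × T → ENNReal) :=
  Measurable.tsum fun _ => measurable_const.indicator (measurableSet_dist_le _)

theorem UnitAddTorus.volume_prod_dist_le
    [IsProbabilityMeasure (volume : Measure (UnitAddTorus (Fin d)))] {r : ℝ} (hr : 0 ≤ r) :
    ((volume : Measure (UnitAddTorus (Fin d))).prod volume) {p | dist p.1 p.2 ≤ r} ≤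
      ENNReal.ofReal ((2 * r) ^ d) := by
  rw [Measure.prod_apply (measurableSet_dist_le r)]
  calc _ ≤ ∫⁻ _ : UnitAddTorus (Fin d), ENNReal.ofReal ((2 * r) ^ d) := by
        refine lintegral_mono fun x => ?_
        refine le_trans (measure_mono fun y hy => ?_) (UnitAddTorus.volume_closedBall_le x hr)
        rw [Metric.mem_closedBall']
        exact hy
    _ = _ := by rw [lintegral_const, measure_univ, mul_one]

/-- The number of scales that do not separate two points, in terms of the last of these scales. -/
theorem pow_closeScales_le_tsum {T : Type*} [PseudoMetricSpace T] {ρ : ℕ → ℝ} {Q : ENNReal}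
    (hQ : 1 ≤ Q) {j : ℕ} (K : ℕ) {p : T × T} (hp : dist p.1 p.2 ≤ 2 * ρ j) :
    Q ^ closeScales ρ K p ≤ ∑' i, {p : T × T | dist p.1 p.2 ≤ 2 * ρ (j + i)}.indicator
      (fun _ => Q ^ (j + i + 1)) p := by
  suffices h : ∃ m, j ≤ m ∧ dist p.1 p.2 ≤ 2 * ρ m ∧ closeScales ρ K p ≤ m + 1 by
    obtain ⟨m, hjm, hm, hle⟩ := h
    refine le_trans ?_ (ENNReal.le_tsum (m - j))
    rw [Nat.add_sub_cancel' hjm,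
      Set.indicator_of_mem (show p ∈ {p : T × T | dist p.1 p.2 ≤ 2 * ρ m} from hm)]
    exact pow_le_pow_right₀ hQ hle
  rcases le_or_gt (closeScales ρ K p) (j + 1) with h | h
  · exact ⟨j, le_rfl, hp, h⟩
  · obtain ⟨s, hs, hsd⟩ : ∃ s : Finset ℕ, s.card = closeScales ρ K p ∧
        ∀ i ∈ s, dist p.1 p.2 ≤ 2 * ρ i :=
      ⟨_, rfl, fun i hi => (Finset.mem_filter.1 hi).2⟩
    have hne : s.Nonempty := Finset.card_pos.1 (by omega)
    have hsub : s ⊆ Finset.range (s.max' hne + 1) := fun i hi =>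
      Finset.mem_range.2 (Nat.lt_succ_of_le (s.le_max' i hi))
    have hle := Finset.card_le_card hsub
    rw [Finset.card_range] at hle
    exact ⟨s.max' hne, by omega, hsd _ (s.max'_mem hne), by omega⟩

variable [IsProbabilityMeasure (volume : Measure (UnitAddTorus (Fin d)))] {R v : ℝ} {Q : ENNReal}

/-- The integral of the bound of `pow_closeScales_le_tsum` is a geometric series. -/
theorem lintegral_tsum_scales_le (hR : 0 ≤ R) (hv : 0 ≤ v) (j : ℕ) :
    ∫⁻ p : UnitAddTorus (Fin d) × UnitAddTorus (Fin d),
      ∑' i, {p : UnitAddTorus (Fin d) × UnitAddTorus (Fin d) |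
        dist p.1 p.2 ≤ 2 * (R * v ^ (j + i))}.indicator (fun _ => Q ^ (j + i + 1)) p
          ∂(volume.prod volume) ≤
      Q * ENNReal.ofReal ((4 * R) ^ d) * (1 - Q * ENNReal.ofReal (v ^ d))⁻¹ *
        (Q * ENNReal.ofReal (v ^ d)) ^ j := by
  rw [lintegral_tsum fun i =>
    (measurable_const.indicator (measurableSet_dist_le _)).aemeasurable]
  calc _ ≤ ∑' i, Q * ENNReal.ofReal ((4 * R) ^ d) * (Q * ENNReal.ofReal (v ^ d)) ^ j *
        (Q * ENNReal.ofReal (v ^ d)) ^ i := by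
        refine ENNReal.tsum_le_tsum fun i => ?_
        rw [lintegral_indicator_const (measurableSet_dist_le _)]
        refine (mul_le_mul' le_rfl
          (UnitAddTorus.volume_prod_dist_le (by positivity))).trans (le_of_eq ?_)
        rw [show (2 * (2 * (R * v ^ (j + i)))) ^ d = (4 * R) ^ d * (v ^ d) ^ (j + i) by
          rw [← pow_mul, mul_comm d, pow_mul, ← mul_pow]; ring,
          ENNReal.ofReal_mul (by positivity),
          ENNReal.ofReal_pow (p := v ^ d) (by positivity)]
        ring
    _ = _ := by
        rw [ENNReal.tsum_mul_left, ENNReal.tsum_geometric]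
        ring

theorem lintegral_pow_closeScales_le (hQ : 1 ≤ Q) (hR : 0 ≤ R) (hv : 0 ≤ v) (K : ℕ) :
    ∫⁻ p : UnitAddTorus (Fin d) × UnitAddTorus (Fin d),
      Q ^ closeScales (fun i => R * v ^ i) K p ∂(volume.prod volume) ≤
      1 + Q * ENNReal.ofReal ((4 * R) ^ d) * (1 - Q * ENNReal.ofReal (v ^ d))⁻¹ := by
  have h := lintegral_tsum_scales_le (d := d) (Q := Q) hR hv 0
  rw [pow_zero, mul_one] at h
  refine le_trans ?_ (add_le_add le_rfl h)
  calc _ ≤ ∫⁻ p : UnitAddTorus (Fin d) × UnitAddTorus (Fin d),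
        (1 + ∑' i, {p : UnitAddTorus (Fin d) × UnitAddTorus (Fin d) |
          dist p.1 p.2 ≤ 2 * (R * v ^ (0 + i))}.indicator (fun _ => Q ^ (0 + i + 1)) p)
            ∂(volume.prod volume) := by
        refine lintegral_mono fun p => ?_
        by_cases h : ∃ j < K, dist p.1 p.2 ≤ 2 * (R * v ^ j)
        · obtain ⟨j, -, hj⟩ := h
          refine le_trans (pow_closeScales_le_tsum hQ K (ρ := fun i => R * v ^ i) hj) ?_
          refine le_trans ?_ le_add_self
          -- the sum over the scales from `j` on is a part of the sum over all scales
          simp only [zero_add]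
          exact ENNReal.tsum_comp_le_tsum_of_injective (add_right_injective j)
            (fun i => {p : UnitAddTorus (Fin d) × UnitAddTorus (Fin d) |
              dist p.1 p.2 ≤ 2 * (R * v ^ i)}.indicator (fun _ => Q ^ (i + 1)) p)
        · have : closeScales (fun i => R * v ^ i) K p = 0 := by
            unfold closeScales
            rw [Finset.card_eq_zero, Finset.filter_eq_empty_iff]
            intro i hi hle
            exact h ⟨i, Finset.mem_range.1 hi, hle⟩
          rw [this, pow_zero]
          exact le_self_add
    _ = _ := by
        rw [lintegral_add_left measurable_const, lintegral_const, measure_univ, mul_one]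

theorem lintegral_scaleKernel_mul_le (hQ : 1 ≤ Q) (hR : 0 ≤ R) (hv : 0 ≤ v) {β : ENNReal} (K : ℕ) :
    ∫⁻ p : UnitAddTorus (Fin d) × UnitAddTorus (Fin d),
      scaleKernel (fun j => R * v ^ j) (fun j => β ^ j) p *
        Q ^ closeScales (fun i => R * v ^ i) K p ∂(volume.prod volume) ≤
      Q * ENNReal.ofReal ((4 * R) ^ d) * (1 - Q * ENNReal.ofReal (v ^ d))⁻¹ *
        (1 - Q * ENNReal.ofReal (v ^ d) / β)⁻¹ := by
  let S : ℕ → UnitAddTorus (Fin d) × UnitAddTorus (Fin d) → ENNReal := fun j p =>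
    ∑' i, {p : UnitAddTorus (Fin d) × UnitAddTorus (Fin d) |
        dist p.1 p.2 ≤ 2 * (R * v ^ (j + i))}.indicator (fun _ => Q ^ (j + i + 1)) p
  have hS : ∀ j, Measurable (S j) := fun j =>
    Measurable.tsum fun _ => measurable_const.indicator (measurableSet_dist_le _)
  calc _ ≤ ∫⁻ p : UnitAddTorus (Fin d) × UnitAddTorus (Fin d),
        ∑' j, (β ^ j)⁻¹ * S j p ∂(volume.prod volume) := by
        refine lintegral_mono fun p => ?_
        simp only [scaleKernel]
        rw [← ENNReal.tsum_mul_right]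
        refine ENNReal.tsum_le_tsum fun j => ?_
        by_cases h : dist p.1 p.2 ≤ 2 * (R * v ^ j)
        · rw [Set.indicator_of_mem (by exact h)]
          gcongr
          exact pow_closeScales_le_tsum hQ K (ρ := fun i => R * v ^ i) h
        · rw [Set.indicator_of_notMem (by exact h), zero_mul]
          exact zero_le
    _ = ∑' j, (β ^ j)⁻¹ * ∫⁻ p, S j p ∂(volume.prod volume) := by
        rw [lintegral_tsum fun j => ((hS j).const_mul _).aemeasurable]
        simp only [lintegral_const_mul _ (hS _)]
    _ ≤ ∑' j, Q * ENNReal.ofReal ((4 * R) ^ d) * (1 - Q * ENNReal.ofReal (v ^ d))⁻¹ *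
          (Q * ENNReal.ofReal (v ^ d) / β) ^ j := by
        refine ENNReal.tsum_le_tsum fun j => ?_
        refine (mul_le_mul' le_rfl (lintegral_tsum_scales_le hR hv j)).trans (le_of_eq ?_)
        rw [div_eq_mul_inv, mul_pow _ β⁻¹, ENNReal.inv_pow]
        ring
    _ = _ := by rw [ENNReal.tsum_mul_left, ENNReal.tsum_geometric]

end Integrals

section Tonelli

variable {Ω : Type*} [MeasurableSpace Ω] {P : Measure Ω} [SFinite P] {T : Type*}
  [MeasurableSpace T] {ν : Measure T} [SFinite ν] {F : Ω → Set T} {κ : T × T → ENNReal}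

theorem lintegral_prod_restrict_eq (hF : MeasurableSet {q : Ω × T | q.2 ∈ F q.1}) (a : Ω) :
    ∫⁻ p, κ p ∂((ν.restrict (F a)).prod (ν.restrict (F a))) =
      ∫⁻ p, {q : Ω × (T × T) | q.2.1 ∈ F q.1 ∧ q.2.2 ∈ F q.1}.indicator (fun q => κ q.2) (a, p)
        ∂(ν.prod ν) := by
  have hFa : MeasurableSet (F a) := measurable_prodMk_left hF
  rw [Measure.prod_restrict, ← lintegral_indicator (hFa.prod hFa)]
  rfl

theorem measurableSet_pair_mem (hF : MeasurableSet {q : Ω × T | q.2 ∈ F q.1}) :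
    MeasurableSet {q : Ω × (T × T) | q.2.1 ∈ F q.1 ∧ q.2.2 ∈ F q.1} :=
  ((measurable_fst.prodMk (measurable_fst.comp measurable_snd)) hF).inter
    ((measurable_fst.prodMk (measurable_snd.comp measurable_snd)) hF)

theorem measurable_lintegral_prod_restrict (hF : MeasurableSet {q : Ω × T | q.2 ∈ F q.1})
    (hκ : Measurable κ) :
    Measurable fun a => ∫⁻ p, κ p ∂((ν.restrict (F a)).prod (ν.restrict (F a))) := by
  simp only [lintegral_prod_restrict_eq hF]
  exact ((hκ.comp measurable_snd).indicator (measurableSet_pair_mem hF)).lintegral_prod_right'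

/-- The expected energy of a random set is the integral of the kernel against the two-point
function. -/
theorem lintegral_lintegral_prod_restrict (hF : MeasurableSet {q : Ω × T | q.2 ∈ F q.1})
    (hκ : Measurable κ) :
    ∫⁻ a, ∫⁻ p, κ p ∂((ν.restrict (F a)).prod (ν.restrict (F a))) ∂P =
      ∫⁻ p, κ p * P {a | p.1 ∈ F a ∧ p.2 ∈ F a} ∂(ν.prod ν) := by
  simp only [lintegral_prod_restrict_eq hF]
  rw [lintegral_lintegral_swap (f := fun a p =>
    {q : Ω × (T × T) | q.2.1 ∈ F q.1 ∧ q.2.2 ∈ F q.1}.indicator (fun q => κ q.2) (a, p))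
    ((hκ.comp measurable_snd).indicator
    (measurableSet_pair_mem hF)).aemeasurable]
  refine lintegral_congr fun p => ?_
  have hm : MeasurableSet {a | p.1 ∈ F a ∧ p.2 ∈ F a} :=
    measurable_prodMk_right (measurableSet_pair_mem hF)
  rw [← lintegral_indicator_const hm]
  rfl

end Tonelli

/-- Chebyshev's inequality in the form `(1 / 4) 1_{x < 1 / 2} + 2 x ≤ x ^ 2 + 1`. -/
theorem measure_lt_half_le {Ω : Type*} [MeasurableSpace Ω] {P : Measure Ω} [IsProbabilityMeasure P]
    {f : Ω → ENNReal} (hf : Measurable f) (h1 : ∫⁻ a, f a ∂P = 1) {η : ENNReal}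
    (h2 : ∫⁻ a, f a * f a ∂P ≤ 1 + η) : P {a | f a < 1 / 2} ≤ 4 * η := by
  have hm : MeasurableSet {a | f a < 1 / 2} := measurableSet_lt hf measurable_const
  have hpt : ∀ a, {a | f a < 1 / 2}.indicator (fun _ => (1 / 4 : ENNReal)) a + 2 * f a ≤
      f a * f a + 1 := by
    intro a
    rcases eq_or_ne (f a) ⊤ with htop | htop
    · simp [htop]
    obtain ⟨x, hx⟩ : ∃ x : NNReal, f a = x := ⟨(f a).toNNReal, (ENNReal.coe_toNNReal htop).symm⟩
    by_cases h : f a < 1 / 2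
    · rw [Set.indicator_of_mem (by exact h), hx]
      rw [hx] at h
      have hx2 : x < 1 / 2 := by
        rw [← ENNReal.coe_lt_coe]; simpa using h
      have : (1 / 4 : NNReal) + 2 * x ≤ x * x + 1 := by
        rw [← NNReal.coe_le_coe]
        rw [← NNReal.coe_lt_coe] at hx2
        push_cast at hx2 ⊢
        nlinarith
      have h' := ENNReal.coe_le_coe.2 this
      push_cast at h'
      exact h'
    · rw [Set.indicator_of_notMem (by exact h), hx, zero_add]
      have : 2 * x ≤ x * x + 1 := by
        rw [← NNReal.coe_le_coe]
        push_cast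
        nlinarith [sq_nonneg ((x : ℝ) - 1)]
      exact_mod_cast this
  have hint := lintegral_mono (μ := P) hpt
  rw [lintegral_add_left (measurable_const.indicator hm), lintegral_indicator_const hm,
    lintegral_const_mul _ hf, h1, lintegral_add_right _ measurable_const, lintegral_const,
    measure_univ] at hint
  have h3 : 1 / 4 * P {a | f a < 1 / 2} + 2 ≤ η + 2 := by
    calc _ ≤ (1 + η) + 1 := by
          refine le_trans (by simpa using hint) (add_le_add h2 le_rfl)
      _ = _ := by ring_nf
  have h4 := (ENNReal.add_le_add_iff_right (by norm_num)).1 h3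
  calc P {a | f a < 1 / 2} = 4 * (1 / 4 * P {a | f a < 1 / 2}) := by
        rw [← mul_assoc, ENNReal.mul_div_cancel (by norm_num) (by norm_num), one_mul]
    _ ≤ _ := by gcongr

/-! ### Positive Hausdorff measure with high probability -/

section Positive

variable {Ω : Type*} [MeasurableSpace Ω] {P : Measure Ω} [IsProbabilityMeasure P] {d : ℕ}
  {X : ℕ → Ω → UnitAddTorus (Fin d)} {N : ℕ → ℕ} {ρ : ℕ → ℝ}

/-- The uniform measure on the points hit by the first `K` blocks, normalised so as to have
expected mass one. -/
noncomputable def hitMeasure (d : ℕ) (N : ℕ → ℕ) (ρ : ℕ → ℝ) (K : ℕ)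
    (x : ℕ → UnitAddTorus (Fin d)) : Measure (UnitAddTorus (Fin d)) :=
  (ENNReal.ofReal (∏ i ∈ Finset.range K, hitProb d N ρ i))⁻¹ • volume.restrict (hitUpTo N ρ K x)

instance (K : ℕ) (x : ℕ → UnitAddTorus (Fin d)) : SFinite (hitMeasure d N ρ K x) := by
  unfold hitMeasure; infer_instance

theorem hitMeasure_univ (K : ℕ) (x : ℕ → UnitAddTorus (Fin d)) : hitMeasure d N ρ K x Set.univ =
    (ENNReal.ofReal (∏ i ∈ Finset.range K, hitProb d N ρ i))⁻¹ * volume (hitUpTo N ρ K x) := by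
  simp [hitMeasure]

theorem lintegral_prod_hitMeasure (κ : UnitAddTorus (Fin d) × UnitAddTorus (Fin d) → ENNReal)
    (K : ℕ) (x : ℕ → UnitAddTorus (Fin d)) :
    ∫⁻ p, κ p ∂((hitMeasure d N ρ K x).prod (hitMeasure d N ρ K x)) =
      (ENNReal.ofReal (∏ i ∈ Finset.range K, hitProb d N ρ i))⁻¹ ^ 2 *
        ∫⁻ p, κ p ∂((volume.restrict (hitUpTo N ρ K x)).prod
          (volume.restrict (hitUpTo N ρ K x))) := by
  rw [hitMeasure, Measure.prod_smul_left, Measure.prod_smul_right, lintegral_smul_measure,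
    lintegral_smul_measure, smul_eq_mul, smul_eq_mul, ← mul_assoc, sq]

theorem lintegral_hitMeasure_univ (hX : ∀ n, Measurable (X n)) (hind : iIndepFun X P)
    (hunif : ∀ n, Measure.map (X n) P = volume) (hN : Monotone N) (hρ : ∀ i, 0 ≤ ρ i)
    (hρ' : ∀ i, 2 * ρ i ≤ 1) (hq : ∀ i, 0 < hitProb d N ρ i) (K : ℕ) :
    ∫⁻ a, hitMeasure d N ρ K (fun n => X n a) Set.univ ∂P = 1 := by
  have : IsProbabilityMeasure (volume : Measure (UnitAddTorus (Fin d))) :=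
    hunif 0 ▸ Measure.isProbabilityMeasure_map (hX 0).aemeasurable
  have hm := measurableSet_mem_hitUpTo (N := N) (ρ := ρ) hX K
  have hvm : Measurable fun a => volume (hitUpTo N ρ K (fun n => X n a)) :=
    measurable_measure_prodMk_left hm
  have hint : ∫⁻ a, volume (hitUpTo N ρ K (fun n => X n a)) ∂P =
      ENNReal.ofReal (∏ i ∈ Finset.range K, hitProb d N ρ i) := by
    have h1 := Measure.prod_apply (μ := P) (ν := (volume : Measure (UnitAddTorus (Fin d)))) hm
    have h2 := Measure.prod_apply_symm (μ := P) (ν := (volume : Measure (UnitAddTorus (Fin d)))) hm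
    calc _ = ∫⁻ y : UnitAddTorus (Fin d), P {a | y ∈ hitUpTo N ρ K (fun n => X n a)} :=
          h1.symm.trans h2
      _ = _ := by
          simp only [measure_mem_hitUpTo hX hind hunif hN hρ hρ', lintegral_const, measure_univ,
            mul_one]
  simp only [hitMeasure_univ]
  rw [lintegral_const_mul _ hvm, hint]
  refine ENNReal.inv_mul_cancel ?_ ENNReal.ofReal_ne_top
  rw [Ne, ENNReal.ofReal_eq_zero, not_le]
  exact Finset.prod_pos fun i _ => hq i

theorem lintegral_energy_hitMeasure_le (hX : ∀ n, Measurable (X n)) (hind : iIndepFun X P)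
    (hunif : ∀ n, Measure.map (X n) P = volume) (hN : Monotone N) (hρ : ∀ i, 0 ≤ ρ i)
    (hρ' : ∀ i, 2 * ρ i ≤ 1) (hq : ∀ i, 0 < hitProb d N ρ i) {Q : ℝ} (hQ : 0 < Q)
    (hQq : ∀ i, 1 ≤ Q * hitProb d N ρ i)
    (K : ℕ) {κ : UnitAddTorus (Fin d) × UnitAddTorus (Fin d) → ENNReal} (hκ : Measurable κ) :
    ∫⁻ a, ∫⁻ p, κ p ∂((hitMeasure d N ρ K (fun n => X n a)).prod
        (hitMeasure d N ρ K (fun n => X n a))) ∂P ≤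
      ∫⁻ p, κ p * ENNReal.ofReal Q ^ closeScales ρ K p ∂(volume.prod volume) := by
  have hm := measurableSet_mem_hitUpTo (N := N) (ρ := ρ) hX K
  have hpos : 0 < ∏ i ∈ Finset.range K, hitProb d N ρ i := Finset.prod_pos fun i _ => hq i
  have h0 : ENNReal.ofReal (∏ i ∈ Finset.range K, hitProb d N ρ i) ≠ 0 := by
    rw [Ne, ENNReal.ofReal_eq_zero, not_le]
    exact hpos
  simp only [lintegral_prod_hitMeasure]
  rw [lintegral_const_mul _ (measurable_lintegral_prod_restrict hm hκ),
    lintegral_lintegral_prod_restrict hm hκ, ← lintegral_const_mul' _ _ (by simp [h0])]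
  refine lintegral_mono fun p => ?_
  refine (mul_le_mul' le_rfl (mul_le_mul' le_rfl
    (measure_mem_hitUpTo_inter_le hX hind hunif hN hρ hρ' hQ hQq K p))).trans (le_of_eq ?_)
  rw [ENNReal.ofReal_pow hpos.le]
  set w := ENNReal.ofReal (∏ i ∈ Finset.range K, hitProb d N ρ i)
  calc _ = (w⁻¹ * w) ^ 2 * (κ p * ENNReal.ofReal Q ^ closeScales ρ K p) := by ring
    _ = _ := by rw [ENNReal.inv_mul_cancel h0 ENNReal.ofReal_ne_top, one_pow, one_mul]

/-- If the hitting probabilities are at least `Q⁻¹` with `Q v ^ d < v ^ t`, then the set of points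
hit by every block has positive `t`-dimensional Hausdorff measure, up to a small probability. -/
theorem measure_hausdorffMeasure_eq_zero_le (hX : ∀ n, Measurable (X n)) (hind : iIndepFun X P)
    (hunif : ∀ n, Measure.map (X n) P = volume) (hN : Monotone N) {R v t Q : ℝ} (hR : 0 < R)
    (hR' : 2 * R ≤ 1) (hv : 0 < v) (hv1 : v < 1) (ht : 0 < t) (hQ : 1 ≤ Q)
    (hQq : ∀ i, 1 ≤ Q * hitProb d N (fun i => R * v ^ i) i) (hQv : Q * v ^ d < v ^ t) :
    P {a | Measure.hausdorffMeasure t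
        (⋂ K, hitUpTo N (fun i => R * v ^ i) K (fun n => X n a)) = 0} ≤
      5 * (ENNReal.ofReal Q * ENNReal.ofReal ((4 * R) ^ d) *
        (1 - ENNReal.ofReal Q * ENNReal.ofReal (v ^ d))⁻¹) := by
  have : IsProbabilityMeasure (volume : Measure (UnitAddTorus (Fin d))) :=
    hunif 0 ▸ Measure.isProbabilityMeasure_map (hX 0).aemeasurable
  set ρ : ℕ → ℝ := fun i => R * v ^ i with hρdef
  have hQ0 : 0 < Q := by linarith
  have hρ : ∀ i, 0 ≤ ρ i := fun i => by positivity
  have hρ' : ∀ i, 2 * ρ i ≤ 1 := fun i => by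
    have : R * v ^ i ≤ R * 1 := by
      gcongr
      exact pow_le_one₀ hv.le hv1.le
    simp only [hρdef]
    linarith
  have hq : ∀ i, 0 < hitProb d N ρ i := fun i => by
    by_contra h
    nlinarith [hQq i, mul_nonneg hQ0.le (neg_nonneg.2 (not_lt.1 h))]
  set q : ENNReal := ENNReal.ofReal Q
  have hq1 : 1 ≤ q := by
    rw [← ENNReal.ofReal_one]; exact ENNReal.ofReal_le_ofReal hQ
  set H := q * ENNReal.ofReal ((4 * R) ^ d) * (1 - q * ENNReal.ofReal (v ^ d))⁻¹ with hH
  set β := ENNReal.ofReal (v ^ t) with hβ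
  have hvt : 0 < v ^ t := by positivity
  have hβ0 : β ≠ 0 := by rw [hβ, Ne, ENNReal.ofReal_eq_zero, not_le]; exact hvt
  let C := (1 - q * ENNReal.ofReal (v ^ d) / β)⁻¹
  have hlt : q * ENNReal.ofReal (v ^ d) / β < 1 := by
    rw [ENNReal.div_lt_iff (Or.inl hβ0) (Or.inl ENNReal.ofReal_ne_top), one_mul,
      ← ENNReal.ofReal_mul hQ0.le]
    exact (ENNReal.ofReal_lt_ofReal_iff hvt).2 hQv
  have hC' : C ≠ ⊤ := ENNReal.inv_ne_top.2 (tsub_pos_of_lt hlt).ne'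
  have hC : C ≠ 0 := ENNReal.inv_ne_zero.2 (ne_top_of_le_ne_top ENNReal.one_ne_top tsub_le_self)
  let μ : ℕ → Ω → Measure (UnitAddTorus (Fin d)) := fun K a => hitMeasure d N ρ K (fun n => X n a)
  let I : ℕ → Ω → ENNReal := fun K a =>
    ∫⁻ p, scaleKernel ρ (fun j => β ^ j) p ∂((μ K a).prod (μ K a))
  let bad : ℕ → Set Ω := fun K => {a | μ K a Set.univ < 1 / 2} ∪ {a | C < I K a}
  have hmass : ∀ K, P {a | μ K a Set.univ < 1 / 2} ≤ 4 * H := by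
    intro K
    have hm := measurableSet_mem_hitUpTo (N := N) (ρ := ρ) hX K
    refine measure_lt_half_le ?_ (lintegral_hitMeasure_univ hX hind hunif hN hρ hρ' hq K) ?_
    · simp only [hitMeasure_univ]
      exact (measurable_measure_prodMk_left hm).const_mul _
    · have h := lintegral_energy_hitMeasure_le hX hind hunif hN hρ hρ' hq hQ0 hQq K
        (κ := fun _ => 1) measurable_const
      simp only [lintegral_const, one_mul, ← Set.univ_prod_univ, Measure.prod_prod] at h
      exact h.trans (lintegral_pow_closeScales_le hq1 hR.le hv.le K)
  have henergy : ∀ K, P {a | C < I K a} ≤ H := by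
    intro K
    have hm := measurableSet_mem_hitUpTo (N := N) (ρ := ρ) hX K
    have hκ := measurable_scaleKernel (T := UnitAddTorus (Fin d)) ρ (fun j => β ^ j)
    have hIm : Measurable (I K) := by
      simp only [I, μ, lintegral_prod_hitMeasure]
      exact (measurable_lintegral_prod_restrict hm hκ).const_mul _
    have hI : ∫⁻ a, I K a ∂P ≤ H * C :=
      (lintegral_energy_hitMeasure_le hX hind hunif hN hρ hρ' hq hQ0 hQq K hκ).trans
        (lintegral_scaleKernel_mul_le hq1 hR.le hv.le K)
    calc P {a | C < I K a} ≤ P {a | C ≤ I K a} := measure_mono fun a ha =>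
          le_of_lt (show C < I K a from ha)
      _ ≤ (∫⁻ a, I K a ∂P) / C := meas_ge_le_lintegral_div hIm.aemeasurable hC hC'
      _ ≤ (H * C) / C := ENNReal.div_le_div_right hI _
      _ = H := ENNReal.mul_div_cancel_right hC hC'
  have hbad : ∀ K, P (bad K) ≤ 5 * H := fun K =>
    calc P (bad K) ≤ 4 * H + H := (measure_union_le _ _).trans (add_le_add (hmass K) (henergy K))
      _ = 5 * H := by ring
  -- failure means that all the measures from some index on are bad
  have hsub : {a | Measure.hausdorffMeasure t (⋂ K, hitUpTo N ρ K (fun n => X n a)) = 0} ⊆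
      ⋃ K₀, ⋂ K ≥ K₀, bad K := by
    intro a ha
    by_contra hnot
    refine hausdorffMeasure_iInter_ne_zero (fun K => isClosed_hitUpTo (N := N) (ρ := ρ) K _)
      (hitUpTo_antitone _) hR hv hv1 ht hC hC' (μ := fun K => μ K a) (fun K => ?_) ?_ ha
    · simp only [μ, hitMeasure, Measure.smul_apply, smul_eq_mul]
      rw [Measure.restrict_apply (isClosed_hitUpTo K _).measurableSet.compl, Set.compl_inter_self,
        measure_empty, mul_zero]
    · rw [Filter.frequently_atTop]
      intro K₀
      simp only [Set.mem_iUnion, Set.mem_iInter, not_exists, not_forall] at hnot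
      obtain ⟨K, hK, hgood⟩ := hnot K₀
      simp only [bad, Set.mem_union, Set.mem_ofPred_eq, not_or, not_lt] at hgood
      exact ⟨K, hK, hgood⟩
  refine (measure_mono hsub).trans ?_
  have hmono : Monotone fun K₀ => ⋂ K ≥ K₀, bad K := fun K₀ K₁ h =>
    Set.biInter_subset_biInter_left fun K hK => le_trans h hK
  rw [hmono.measure_iUnion]
  exact iSup_le fun K₀ => (measure_mono (Set.biInter_subset_of_mem le_rfl)).trans (hbad K₀)

end Positive

/-! ### Almost sure lower bound -/

section LowerBound

variable {d : ℕ} {c θ : ℝ}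

/-- The limiting probability that a given point is hit by a block. -/
noncomputable def limitHitProb (d : ℕ) (c θ : ℝ) : ℝ :=
  1 - Real.exp (-((2 * c) ^ d * ((θ - 1) / θ ^ 2)))

theorem limitHitProb_pos (hc : 0 < c) (hθ : 1 < θ) : 0 < limitHitProb d c θ := by
  have h1 : 0 < θ - 1 := by linarith
  have : 0 < (2 * c) ^ d * ((θ - 1) / θ ^ 2) := by positivity
  unfold limitHitProb
  rw [sub_pos, Real.exp_lt_one_iff]
  linarith

theorem ratio_lt_limitHitProb_of_lt_lowerDimBound (hd : 1 ≤ d) (hc : 0 < c) (hθ : 1 < θ) {t : ℝ}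
    (ht : t < lowerDimBound d c θ) :
    (θ ^ (-(1 / (d : ℝ)))) ^ d < (θ ^ (-(1 / (d : ℝ)))) ^ t * limitHitProb d c θ := by
  have hθ0 : 0 < θ := by linarith
  have hd0 : (0 : ℝ) < d := by positivity
  have hlog := Real.log_pos hθ
  have hq := limitHitProb_pos (d := d) hc hθ
  have ht' : t < d * (1 + Real.log (limitHitProb d c θ) / Real.log θ) := ht
  rw [← Real.log_lt_log_iff (by positivity) (by positivity), Real.log_mul (by positivity) hq.ne',
    scale_ratio_pow hd hθ, Real.log_inv, Real.log_rpow (by positivity), Real.log_rpow hθ0]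
  have h2 : t * Real.log θ / d < Real.log θ + Real.log (limitHitProb d c θ) := by
    rw [div_lt_iff₀ hd0]
    calc t * Real.log θ < d * (1 + Real.log (limitHitProb d c θ) / Real.log θ) * Real.log θ := by
          gcongr
      _ = _ := by field_simp
  have h3 : t * (-(1 / (d : ℝ)) * Real.log θ) = -(t * Real.log θ / d) := by ring
  linarith

/-- The hitting probabilities of the blocks `⌊θ ^ k⌋ ≤ n < ⌊θ ^ (k + 1)⌋` at the scales
`c θ ^ (-(k + 2) / d)` exceed every number below `limitHitProb`. -/
theorem eventually_lt_hitProb (hd : 1 ≤ d) (hc : 0 < c) (hθ : 1 < θ) {q : ℝ}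
    (hq : q < limitHitProb d c θ) : ∀ᶠ k in atTop,
      q < hitProb d (fun k => ⌊θ ^ k⌋₊) (fun k => scale d c θ (k + 2)) k := by
  have hθ0 : 0 < θ := by linarith
  set A := (2 * c) ^ d with hA
  have hA0 : 0 < A := by positivity
  have hV : ∀ k, (2 * scale d c θ (k + 2)) ^ d = A * (θ⁻¹) ^ (k + 2) := fun k => by
    rw [scale, ← mul_assoc, mul_pow, ← pow_mul, mul_comm (k + 2) d, pow_mul, scale_ratio_pow hd hθ]
  have hinv : Tendsto (fun k : ℕ => (θ⁻¹) ^ (k + 2)) atTop (nhds 0) :=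
    (tendsto_pow_atTop_nhds_zero_of_lt_one (by positivity) (inv_lt_one_of_one_lt₀ hθ)).comp
      (tendsto_add_atTop_nat 2)
  have hVlim : Tendsto (fun k : ℕ => A * (θ⁻¹) ^ (k + 2)) atTop (nhds 0) := by
    have := hinv.const_mul A
    rwa [mul_zero] at this
  have hlim : Tendsto (fun k : ℕ => 1 - Real.exp (-(A * ((θ - 1) / θ ^ 2) - A * (θ⁻¹) ^ (k + 2))))
      atTop (nhds (limitHitProb d c θ)) := by
    have h1 := (hVlim.const_sub (A * ((θ - 1) / θ ^ 2))).neg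
    rw [sub_zero] at h1
    exact ((Real.continuous_exp.tendsto _).comp h1).const_sub 1
  filter_upwards [hlim.eventually (lt_mem_nhds hq), hVlim.eventually (gt_mem_nhds one_pos)]
    with k hk hk1
  refine hk.trans_le ?_
  unfold hitProb
  rw [hV]
  set V := A * (θ⁻¹) ^ (k + 2) with hVdef
  have hV0 : 0 ≤ V := by positivity
  have hmono : ⌊θ ^ k⌋₊ ≤ ⌊θ ^ (k + 1)⌋₊ :=
    Nat.floor_mono (pow_le_pow_right₀ hθ.le (Nat.le_succ k))
  have hcount : θ ^ (k + 1) - θ ^ k - 1 ≤ ((⌊θ ^ (k + 1)⌋₊ - ⌊θ ^ k⌋₊ : ℕ) : ℝ) := by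
    rw [Nat.cast_sub hmono]
    have h1 := Nat.lt_floor_add_one (θ ^ (k + 1))
    have h2 := Nat.floor_le (show 0 ≤ θ ^ k by positivity)
    linarith
  have hVn : A * ((θ - 1) / θ ^ 2) - V ≤ V * ((⌊θ ^ (k + 1)⌋₊ - ⌊θ ^ k⌋₊ : ℕ) : ℝ) := by
    refine le_trans (le_of_eq ?_) (mul_le_mul_of_nonneg_left hcount hV0)
    rw [hVdef, inv_pow]
    field_simp
    ring
  have hexp : (1 - V) ^ (⌊θ ^ (k + 1)⌋₊ - ⌊θ ^ k⌋₊) ≤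
      Real.exp (-(A * ((θ - 1) / θ ^ 2) - V)) := by
    calc (1 - V) ^ (⌊θ ^ (k + 1)⌋₊ - ⌊θ ^ k⌋₊)
        ≤ Real.exp (-V) ^ (⌊θ ^ (k + 1)⌋₊ - ⌊θ ^ k⌋₊) :=
          pow_le_pow_left₀ (by linarith) (Real.one_sub_le_exp_neg V) _
      _ = Real.exp (-(V * ((⌊θ ^ (k + 1)⌋₊ - ⌊θ ^ k⌋₊ : ℕ) : ℝ))) := by
          rw [← Real.exp_nat_mul]; congr 1; ring
      _ ≤ _ := Real.exp_le_exp.2 (by linarith)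
  linarith

/-- Points hit by all blocks from the `k₀`-th on are covered at all late times: the points of the
`k`-th block take care of the times between `θ ^ (k + 1)` and `θ ^ (k + 2)`. -/
theorem iInter_hitUpTo_subset_coveredFrom {T : Type*} [PseudoMetricSpace T] {c' : ℝ} (hc' : 0 < c')
    (hcc : c' < c) (hθ : 1 < θ) (k₀ : ℕ) (x : ℕ → T) :
    ⋂ K, hitUpTo (fun i => ⌊θ ^ (k₀ + i)⌋₊) (fun i => scale d c' θ (k₀ + i + 2)) K x ⊆
      coveredFrom x (fun M => c / (M : ℝ) ^ (1 / (d : ℝ))) (⌊θ ^ (k₀ + 1)⌋₊) := by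
  intro y hy M hM
  have hθ0 : 0 < θ := by linarith
  have hex : ∃ i, ⌊θ ^ (k₀ + (i + 1))⌋₊ ≤ M ∧ M < ⌊θ ^ (k₀ + (i + 1) + 1)⌋₊ := by
    by_contra! hno
    have hall : ∀ i, ⌊θ ^ (k₀ + (i + 1))⌋₊ ≤ M := by
      intro i
      induction i with
      | zero => exact hM
      | succ i ih => exact hno i ih
    obtain ⟨n, hn⟩ := ((tendsto_pow_atTop_atTop_of_one_lt hθ).eventually_gt_atTop
      ((M : ℝ) + 1)).exists
    have h1 : (M : ℝ) + 1 < θ ^ (k₀ + (n + 1)) :=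
      hn.trans_le (pow_le_pow_right₀ hθ.le (by omega))
    have h2 := Nat.lt_floor_add_one (θ ^ (k₀ + (n + 1)))
    have h3 : ((⌊θ ^ (k₀ + (n + 1))⌋₊ : ℕ) : ℝ) ≤ M := by exact_mod_cast hall n
    linarith
  obtain ⟨i, hi1, hi2⟩ := hex
  have hyi : y ∈ hitSet (fun i => ⌊θ ^ (k₀ + i)⌋₊) (fun i => scale d c' θ (k₀ + i + 2)) i x :=
    Set.mem_iInter₂.1 (Set.mem_iInter.1 hy (i + 1)) i (Finset.self_mem_range_succ i)
  obtain ⟨n, hn, hny⟩ := mem_hitSet.1 hyi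
  refine ⟨n, (Finset.mem_Ico.1 hn).2.trans_le hi1, (Metric.mem_closedBall.1 hny).trans_lt ?_⟩
  have hM1 : 1 ≤ M := le_trans (Nat.le_floor (by rw [Nat.cast_one]; exact one_le_pow₀ hθ.le)) hM
  have hM0 : (0 : ℝ) < M := by exact_mod_cast hM1
  have hMle : (M : ℝ) ≤ θ ^ (k₀ + i + 2) := by
    have h1 : (M : ℝ) ≤ ⌊θ ^ (k₀ + (i + 1) + 1)⌋₊ := by exact_mod_cast hi2.le
    exact h1.trans (Nat.floor_le (by positivity))
  have hpow : (M : ℝ) ^ (1 / (d : ℝ)) ≤ (θ ^ (k₀ + i + 2)) ^ (1 / (d : ℝ)) :=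
    Real.rpow_le_rpow hM0.le hMle (by positivity)
  have hpos : 0 < (M : ℝ) ^ (1 / (d : ℝ)) := by positivity
  rw [scale, scale_pow hθ, Real.rpow_neg (by positivity), ← div_eq_mul_inv]
  calc c' / (θ ^ (k₀ + i + 2)) ^ (1 / (d : ℝ)) ≤ c' / (M : ℝ) ^ (1 / (d : ℝ)) := by gcongr
    _ < c / (M : ℝ) ^ (1 / (d : ℝ)) := by gcongr

variable {Ω : Type*} [MeasurableSpace Ω] {P : Measure Ω} [IsProbabilityMeasure P]

theorem ae_le_dimH_uniformCoveringSet_of_lt (hd : 1 ≤ d) {ω : ℕ+ → Ω → UnitAddTorus (Fin d)}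
    (hmeas : ∀ n, Measurable (ω n)) (hindep : iIndepFun ω P)
    (hunif : ∀ n, Measure.map (ω n) P = (volume : Measure (UnitAddTorus (Fin d))))
    (hc : 0 < c) (hθ : 1 < θ) {t : ℝ} (ht : 0 < t) (htd : t < lowerDimBound d c θ) :
    ∀ᵐ a ∂P, ENNReal.ofReal t ≤
      dimH (uniformCoveringSet (fun n => ω n a) (criticalRadius d c)) := by
  have hθ0 : 0 < θ := by linarith
  set v := θ ^ (-(1 / (d : ℝ))) with hv
  have hv0 : 0 < v := by positivity
  have hv1 : v < 1 := Real.rpow_lt_one_of_one_lt_of_neg hθ (by simp; omega)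
  have hvt : 0 < v ^ t := by positivity
  -- room for closed balls: a slightly smaller constant still satisfies the strict inequality
  obtain ⟨c', ⟨hc'0, hc'c⟩, hc'⟩ : ∃ c', (0 < c' ∧ c' < c) ∧
      v ^ d < v ^ t * limitHitProb d c' θ := by
    have hcont : Tendsto (fun c' => v ^ t * limitHitProb d c' θ) (nhdsWithin c (Set.Iio c))
        (nhds (v ^ t * limitHitProb d c θ)) := by
      refine (Continuous.tendsto ?_ c).mono_left nhdsWithin_le_nhds
      unfold limitHitProb
      fun_prop
    obtain ⟨c', h1, h2⟩ := ((hcont.eventually (lt_mem_nhds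
      (ratio_lt_limitHitProb_of_lt_lowerDimBound hd hc hθ htd))).and
      (Ioo_mem_nhdsLT hc)).exists
    exact ⟨c', h2, h1⟩
  obtain ⟨q, hq1, hq2⟩ : ∃ q, v ^ d / v ^ t < q ∧ q < limitHitProb d c' θ :=
    exists_between (by rwa [div_lt_iff₀' hvt])
  have hq0 : 0 < q := lt_of_le_of_lt (by positivity) hq1
  have hqle : q ≤ 1 := hq2.le.trans (by
    unfold limitHitProb
    linarith [Real.exp_pos (-((2 * c') ^ d * ((θ - 1) / θ ^ 2)))])
  have hQv : q⁻¹ * v ^ d < v ^ t := by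
    rw [div_lt_iff₀ hvt] at hq1
    rwa [inv_mul_lt_iff₀ hq0]
  let X : ℕ → Ω → UnitAddTorus (Fin d) := fun n => ω n.succPNat
  have hX : iIndepFun X P := hindep.precomp Nat.succPNat_injective
  let R : ℕ → ℝ := fun k₀ => c' * v ^ (k₀ + 2)
  have hR0 : ∀ k₀, 0 < R k₀ := fun k₀ => by positivity
  have hRlim : Tendsto R atTop (nhds 0) :=
    (tendsto_scale (c := c') hd hθ).comp (tendsto_add_atTop_nat 2)
  let H : ℕ → ENNReal := fun k₀ => 5 * (ENNReal.ofReal q⁻¹ * ENNReal.ofReal ((4 * R k₀) ^ d) *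
    (1 - ENNReal.ofReal q⁻¹ * ENNReal.ofReal (v ^ d))⁻¹)
  have hHlim : Tendsto H atTop (nhds 0) := by
    have hconst : (1 - ENNReal.ofReal q⁻¹ * ENNReal.ofReal (v ^ d))⁻¹ ≠ ⊤ := by
      refine ENNReal.inv_ne_top.2 (tsub_pos_of_lt ?_).ne'
      rw [← ENNReal.ofReal_mul (by positivity), ENNReal.ofReal_lt_one]
      exact hQv.trans (Real.rpow_lt_one hv0.le hv1 ht)
    have h1 : Tendsto (fun k₀ => ENNReal.ofReal ((4 * R k₀) ^ d)) atTop (nhds 0) := by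
      have h := ENNReal.tendsto_ofReal ((hRlim.const_mul 4).pow d)
      rwa [mul_zero, zero_pow (by omega), ENNReal.ofReal_zero] at h
    have h2 := ENNReal.Tendsto.const_mul (a := 5) (ENNReal.Tendsto.mul_const
      (ENNReal.Tendsto.const_mul (a := ENNReal.ofReal q⁻¹) h1 (Or.inr ENNReal.ofReal_ne_top))
      (Or.inr hconst)) (Or.inr (by norm_num))
    simpa only [mul_zero, zero_mul] using h2
  have hbound : ∀ᶠ k₀ in atTop, P {a | ¬ ENNReal.ofReal t ≤
      dimH (uniformCoveringSet (fun n => ω n a) (criticalRadius d c))} ≤ H k₀ := by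
    obtain ⟨k₁, hk₁⟩ := eventually_atTop.1 (eventually_lt_hitProb hd hc'0 hθ hq2)
    filter_upwards [eventually_ge_atTop k₁,
      hRlim.eventually (gt_mem_nhds (show (0 : ℝ) < 1 / 2 by norm_num))] with k₀ hk₀ hRk
    have hscale : (fun i => scale d c' θ (k₀ + i + 2)) = fun i => R k₀ * v ^ i := by
      funext i
      simp only [scale, R, ← hv]
      ring
    have hprob : ∀ i, 1 ≤ q⁻¹ * hitProb d (fun i => ⌊θ ^ (k₀ + i)⌋₊) (fun i => R k₀ * v ^ i) i := by
      intro i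
      rw [← hscale, ← div_eq_inv_mul, one_le_div hq0]
      exact (hk₁ (k₀ + i) (by omega)).le
    have hmain := measure_hausdorffMeasure_eq_zero_le (X := X) (fun n => hmeas _) hX
      (fun n => hunif _)
      (fun i j h => Nat.floor_mono (pow_le_pow_right₀ hθ.le (Nat.add_le_add_left h k₀)))
      (hR0 k₀) (by linarith) hv0 hv1 ht (one_le_inv₀ hq0 |>.2 hqle) hprob hQv
    refine (measure_mono fun a ha => ?_).trans hmain
    by_contra hne
    refine ha (le_trans (le_dimH_of_hausdorffMeasure_ne_zero (d := t.toNNReal) ?_)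
      (dimH_mono (?_ : ⋂ K, hitUpTo (fun i => ⌊θ ^ (k₀ + i)⌋₊) (fun i => R k₀ * v ^ i) K
        (fun n => X n a) ⊆ _)))
    · rw [Real.coe_toNNReal t ht.le]
      exact hne
    · rw [← hscale, uniformCoveringSet_eq_iUnion]
      refine (iInter_hitUpTo_subset_coveredFrom hc'0 hc'c hθ k₀ _).trans ?_
      exact Set.subset_iUnion_of_subset ⌊θ ^ (k₀ + 1)⌋₊ fun y hy N hN => hy N (by omega)
  rw [ae_iff]
  exact le_antisymm (ge_of_tendsto hHlim hbound) zero_le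

theorem ae_lowerDimBound_le_dimH (hd : 1 ≤ d) {ω : ℕ+ → Ω → UnitAddTorus (Fin d)}
    (hmeas : ∀ n, Measurable (ω n)) (hindep : iIndepFun ω P)
    (hunif : ∀ n, Measure.map (ω n) P = (volume : Measure (UnitAddTorus (Fin d))))
    (hc : 0 < c) (hθ : 1 < θ) :
    ∀ᵐ a ∂P, ENNReal.ofReal (lowerDimBound d c θ) ≤
      dimH (uniformCoveringSet (fun n => ω n a) (criticalRadius d c)) := by
  have h : ∀ᵐ a ∂P, ∀ i : ℕ, ENNReal.ofReal (lowerDimBound d c θ - 1 / ((i : ℝ) + 1)) ≤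
      dimH (uniformCoveringSet (fun n => ω n a) (criticalRadius d c)) := by
    rw [ae_all_iff]
    intro i
    have hi : 0 < 1 / ((i : ℝ) + 1) := by positivity
    rcases le_or_gt (lowerDimBound d c θ - 1 / ((i : ℝ) + 1)) 0 with h | h
    · rw [ENNReal.ofReal_of_nonpos h]
      exact ae_of_all _ fun a => zero_le
    · exact ae_le_dimH_uniformCoveringSet_of_lt hd hmeas hindep hunif hc hθ h (by linarith)
  filter_upwards [h] with a ha
  have hlim := ENNReal.tendsto_ofReal
    (tendsto_one_div_add_atTop_nhds_zero_nat.const_sub (lowerDimBound d c θ))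
  rw [sub_zero] at hlim
  exact le_of_tendsto' hlim ha

end LowerBound

/-! ### The dimension bounds -/

/-- The torus `𝕋^d` is `UnitAddTorus (Fin d)`, with its max-norm distance modulo `ℤ^d` and its
normalised Lebesgue measure `volume`. The supremum, the infimum and the comparisons with the
Hausdorff dimension are taken in the extended reals. -/
theorem mainTheorem5 {Ω : Type*} [MeasurableSpace Ω] (P : Measure Ω) [IsProbabilityMeasure P]
    (d : ℕ) (hd : 1 ≤ d) (ω : ℕ+ → Ω → UnitAddTorus (Fin d))
    (hmeas : ∀ n, Measurable (ω n))
    (hindep : iIndepFun ω P)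
    (hunif : ∀ n, Measure.map (ω n) P = (volume : Measure (UnitAddTorus (Fin d))))
    (c : ℝ) :
    ((1 / 2 : ℝ) < c →
      ∀ᵐ a ∂P, (⨆ θ ∈ Set.Ioi (1 : ℝ), ((lowerDimBound d c θ : ℝ) : EReal)) ≤
        ((dimH (uniformCoveringSet (fun n => ω n a) (criticalRadius d c)) : ENNReal) : EReal)) ∧
    ((0 : ℝ) < c → c < (1 / 2 : ℝ) →
      ∀ᵐ a ∂P,
        ((dimH (uniformCoveringSet (fun n => ω n a) (criticalRadius d c)) : ENNReal) : EReal) ≤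
          ⨅ θ ∈ Set.Ioi (1 : ℝ), ((upperDimBound d c θ : ℝ) : EReal)) := by
  have hne : (Set.Ioi (1 : ℝ)).Nonempty := ⟨2, by norm_num⟩
  constructor
  · intro hc
    -- countably many values of `θ` suffice to approach the supremum
    obtain ⟨u, -, hu, huS⟩ := exists_seq_tendsto_sSup
      (hne.image fun θ : ℝ => ((lowerDimBound d c θ : ℝ) : EReal)) (OrderTop.bddAbove _)
    choose θ hθ hθu using huS
    have h : ∀ᵐ a ∂P, ∀ n, ENNReal.ofReal (lowerDimBound d c (θ n)) ≤
        dimH (uniformCoveringSet (fun n => ω n a) (criticalRadius d c)) :=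
      ae_all_iff.2 fun n => ae_lowerDimBound_le_dimH hd hmeas hindep hunif (by linarith) (hθ n)
    filter_upwards [h] with a ha
    rw [← sSup_image]
    refine le_of_tendsto' hu fun n => ?_
    rw [← hθu n]
    refine le_trans ?_ (EReal.coe_ennreal_le_coe_ennreal_iff.2 (ha n))
    rw [EReal.coe_ennreal_ofReal]
    exact EReal.coe_le_coe_iff.2 (le_max_left _ _)
  · intro hc _
    obtain ⟨u, -, hu, huS⟩ := exists_seq_tendsto_sInf
      (hne.image fun θ : ℝ => ((upperDimBound d c θ : ℝ) : EReal)) (OrderBot.bddBelow _)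
    choose θ hθ hθu using huS
    have h : ∀ᵐ a ∂P, ∀ n, dimH (uniformCoveringSet (fun n => ω n a) (criticalRadius d c)) ≤
        ENNReal.ofReal (upperDimBound d c (θ n)) :=
      ae_all_iff.2 fun n => ae_dimH_uniformCoveringSet_le hd hmeas hindep hunif hc (hθ n)
    filter_upwards [h] with a ha
    rw [← sInf_image]
    refine ge_of_tendsto' hu fun n => ?_
    rw [← hθu n]
    refine le_trans (EReal.coe_ennreal_le_coe_ennreal_iff.2 (ha n)) ?_
    rw [EReal.coe_ennreal_ofReal, max_eq_left (upperDimBound_nonneg hc (hθ n))]
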